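/- **Theorem (Tracking bound under a spatially varying Lipschitz model-error bound).** *Setting.* All vector norms are 2-norms; $(x,u)\in\mathbb R^{n}\times\mathbb R^{m}$ carries the 2-norm of the stacked vector, and $\widehat Q=Q+Q^\top$. Let $\mathcal X\subseteq\mathbb R^{n}$ be open and $\mathcal U\subseteq\mathbb R^{m}$. Let $h(x,u)$ be the true dynamics and $g(x,u)=f(x)+B(x)u$ a control-affine model, and let $M$ assign to each $x\in\mathcal X$ a symmetric positive definite matrix $M(x)$; $f,B,M$ are $C^1$ on $\mathcal X$, and $W=M^{-1}$. The length of a $C^1$ curve $c:[0,1]\to\mathcal X$ is $\int_0^1\sqrt{c_s^\top M(c)c_s}\,ds$, $\mathrm{dist}(p,q)$ is the infimum of the lengths of such curves from $p$ to $q$, and $\mathcal E(p,q)=\mathrm{dist}(p,q)^2$. A minimizing geodesic from $p$ to $q$ is such a curve with constant speed $\sqrt{c_s^\top M(c)c_s}=\mathrm{dist}(p,q)$. Let $(x_i,u_i)$, $1\le i\le N$, be training points with training errors $e_i=\|h(x_i,u_i)-g(x_i,u_i)\|$, let $D=\bigcup_i\{(x,u):\|(x,u)-(x_i,u_i)\|<r\}\subseteq\mathcal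 X\times\mathcal U$, and let $D_x=\{x:\exists u,\ (x,u)\in D\}$. Let $L_{h-g}\ge0$ be a Lipschitz constant of $h-g$ over $D$. Let $\overline\lambda_D$ be the supremum over $x\in D_x$ of the largest eigenvalue of $M(x)$ and $\underline\lambda_D$ the infimum over $x\in D_x$ of the smallest one; assume $\overline\lambda_D<\infty$ and $\underline\lambda_D>0$. Let $t_1<t_2$. On $[t_1,t_2]$ let $(x^*,u^*)$ be a continuous nominal trajectory with values in $D$ and $\dot x^*=f(x^*)+B(x^*)u^*$, and let $x$ be a continuous executed trajectory of the perturbed system $\dot x=f(x)+B(x)u+d$ (right derivatives on $[t_1,t_2)$ suffice). For each $t\in[t_1,t_2]$ let $\gamma_t$ be a minimizing geodesic from $x^*(t)$ to $x(t)$ that lies in $D_x$. *Controller.* The control $u(t)$, $t\in[t_1,t_2)$, comes from a controller that is contracting with rate $\lambda>0$ for the model $g$ and the metric $M$, in one of the following two senses. 1. For all $x\in D_x$, with $B_\perp(x)$ a basis of the null space of $B(x)^\top$ and $B^j$ the columns of $B$, $$B_\perp^\top\big(-\partial_fW+\widehat{\tfrac{\partial f}{\partial x}W}+2\lambda W\big)B_\perp\preceq0,\qquad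 B_\perp^\top\big(\partial_{B^j}W-\widehat{\tfrac{\partial B^j}{\partial x}W}\big)B_\perp=0\quad(1\le j\le m),$$ and $u(t)$ minimizes $\|v-u^*(t)\|$ over the $v\in\mathcal U$ with $$2\gamma_{t,s}(1)^\top M(x(t))\big(f(x(t))+B(x(t))v\big)-2\gamma_{t,s}(0)^\top M(x^*(t))\big(f(x^*(t))+B(x^*(t))u^*(t)\big)\le-2\lambda\,\mathcal E(x^*(t),x(t)),$$ where $\gamma_{t,s}$ is the derivative of $\gamma_t$ in its curve parameter $s$. 2. $u(t)=k(x(t)-x^*(t),x^*(t),u^*(t))$ for a feedback law $k$ with the following properties for every $(x^*,u^*)\in D$: $k(0,x^*,u^*)=u^*$, the map $x\mapsto k(x-x^*,x^*,u^*)$ is $C^1$ on $D_x$, and for all $x\in D_x$ $$\dot M+\widehat{M(A+BK)}+2\lambda M\prec0,$$ where $A=\frac{\partial f}{\partial x}+\sum_j u^j\frac{\partial B^j}{\partial x}$ with $u=k(x-x^*,x^*,u^*)$, $K=\frac{\partial}{\partial x}k(x-x^*,x^*,u^*)$, and $\dot M=\partial_{f+Bu}M$. Let $\bar u_{\rm fb}$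 be continuous on $[t_1,t_2]$ with $\|u(t)-u^*(t)\|\le\bar u_{\rm fb}(t)$ on $[t_1,t_2)$. Suppose that on $[t_1,t_2)$ $$\|d(t)\|\le\min_{1\le i\le N}\big\{L_{h-g}\|(x(t),u(t))-(x_i,u_i)\|+e_i\big\},$$ and that $\mathcal E(x^*(t_1),x(t_1))\le\mathcal E_{t_1}$. *Conclusion.* For $e\ge0$ put $$\mathcal E_{\rm RHS}(t,e)=-2\Big(\lambda-L_{h-g}\sqrt{\overline\lambda_D/\underline\lambda_D}\Big)e+2\sqrt{e\,\overline\lambda_D}\,\min_{1\le i\le N}\Big\{L_{h-g}\big(\|(x^*(t),u^*(t))-(x_i,u_i)\|+\bar u_{\rm fb}(t)\big)+e_i\Big\}.$$ The initial value problem $e(t)=\mathcal E_{t_1}+\int_{t_1}^{t}\mathcal E_{\rm RHS}(\tau,e(\tau))\,d\tau$ on $[t_1,t_2]$ has a largest continuous nonnegative solution $e$, which is its only such solution if $\mathcal E_{t_1}>0$, and for all $t\in[t_1,t_2]$ $$\|x(t)-x^*(t)\|\le\bar\epsilon(t):=\sqrt{e(t)/\underline\lambda_D} =\sqrt{\Big(\mathcal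 E_{t_1}+\int_{t_1}^{t}\mathcal E_{\rm RHS}(\tau,e(\tau))\,d\tau\Big)\Big/\underline\lambda_D}.$$ -/

import Mathlib

open Set MeasureTheory
open scoped NNReal Matrix

noncomputable section

namespace CCM

/-- `ℝⁿ` with the 2-norm. -/
abbrev Vec (n : ℕ) := EuclideanSpace ℝ (Fin n)

/-- State-control pairs `(x, u)`, stacked in one vector and normed by the 2-norm
`‖(x, u)‖ = sqrt (‖x‖ ^ 2 + ‖u‖ ^ 2)`. -/
abbrev StateControl (n m : ℕ) := WithLp 2 (Vec n × Vec m)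

/-- The pair `(x, u)`. -/
abbrev pair {n m : ℕ} (x : Vec n) (u : Vec m) : StateControl n m := WithLp.toLp 2 (x, u)

/-- The control-affine vector field `g(x, u) = f(x) + B(x) u`. -/
def affine {n m : ℕ} (f : Vec n → Vec n) (B : Vec n → Matrix (Fin n) (Fin m) ℝ)
    (x : Vec n) (u : Vec m) : Vec n :=
  f x + WithLp.toLp 2 (B x *ᵥ u.ofLp)

/-! ### Matrix calculus -/

/-- The symmetrization `Q + Qᵀ`. -/
def symHat {n : ℕ} (Q : Matrix (Fin n) (Fin n) ℝ) : Matrix (Fin n) (Fin n) ℝ := Q + Qᵀ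

/-- The Lie derivative `∂_y Q(x) = ∑ᵢ yⁱ ∂Q/∂xⁱ (x)` of a matrix-valued function. -/
def lieDeriv {n p q : ℕ} (Q : Vec n → Matrix (Fin p) (Fin q) ℝ) (y x : Vec n) :
    Matrix (Fin p) (Fin q) ℝ :=
  Matrix.of fun i j => fderiv ℝ (fun z => Q z i j) x y

/-- The Jacobian matrix `∂F/∂x (x)`. -/
def jacobian {n p : ℕ} (F : Vec n → Vec p) (x : Vec n) : Matrix (Fin p) (Fin n) ℝ :=
  Matrix.of fun i j => fderiv ℝ (fun z => F z i) x (EuclideanSpace.single j 1)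

/-- The `j`-th column `Bʲ` of `B`, as a vector field. -/
def column {n m : ℕ} (B : Vec n → Matrix (Fin n) (Fin m) ℝ) (j : Fin m) (x : Vec n) : Vec n :=
  WithLp.toLp 2 (fun i => B x i j)

/-- A matrix-valued function is `C¹` on `S`: each of its entries is. -/
def MatrixC1On {n p q : ℕ} (Q : Vec n → Matrix (Fin p) (Fin q) ℝ) (S : Set (Vec n)) : Prop :=
  ∀ i j, ContDiffOn ℝ 1 (fun x => Q x i j) S

/-- The largest (real) eigenvalue. -/
def maxEig {n : ℕ} (Q : Matrix (Fin n) (Fin n) ℝ) : ℝ := sSup (spectrum ℝ Q)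

/-- The smallest (real) eigenvalue. -/
def minEig {n : ℕ} (Q : Matrix (Fin n) (Fin n) ℝ) : ℝ := sInf (spectrum ℝ Q)

/-- `sup_{x ∈ S}` of the largest eigenvalue of `M(x)`. -/
def supMaxEig {n : ℕ} (M : Vec n → Matrix (Fin n) (Fin n) ℝ) (S : Set (Vec n)) : ℝ :=
  sSup ((fun x => maxEig (M x)) '' S)

/-- `inf_{x ∈ S}` of the smallest eigenvalue of `M(x)`. -/
def infMinEig {n : ℕ} (M : Vec n → Matrix (Fin n) (Fin n) ℝ) (S : Set (Vec n)) : ℝ :=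
  sInf ((fun x => minEig (M x)) '' S)

/-! ### Riemannian distance and energy of the metric `M` on the state space `X ⊆ ℝⁿ` -/

/-- `δᵀ M(x) η`. -/
def metricForm {n : ℕ} (M : Vec n → Matrix (Fin n) (Fin n) ℝ) (x δ η : Vec n) : ℝ :=
  δ.ofLp ⬝ᵥ (M x *ᵥ η.ofLp)

/-- The velocity `c_s(s)` of a curve `c : [0,1] → ℝⁿ` (one-sided at the end points). -/
def velocity {n : ℕ} (c : ℝ → Vec n) (s : ℝ) : Vec n := derivWithin c (Icc 0 1) s

/-- The set `C(p, q)` of continuously differentiable curves `c : [0,1] → X` from `p` to `q`.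
(The distance below is the same for `C¹` and for `C^∞` curves.) -/
def curves {n : ℕ} (X : Set (Vec n)) (p q : Vec n) : Set (ℝ → Vec n) :=
  {c | ContDiffOn ℝ 1 c (Icc 0 1) ∧ (∀ s ∈ Icc (0 : ℝ) 1, c s ∈ X) ∧ c 0 = p ∧ c 1 = q}

/-- The length `∫₀¹ sqrt (c_s(s)ᵀ M(c(s)) c_s(s)) ds`. -/
def curveLength {n : ℕ} (M : Vec n → Matrix (Fin n) (Fin n) ℝ) (c : ℝ → Vec n) : ℝ :=
  ∫ s in (0 : ℝ)..1, √(metricForm M (c s) (velocity c s) (velocity c s))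

/-- The Riemann distance in `X`: the infimum of the lengths of the curves in `X` joining
`p` to `q` (only used for points that can be joined in `X`). -/
def riemannDist {n : ℕ} (X : Set (Vec n)) (M : Vec n → Matrix (Fin n) (Fin n) ℝ)
    (p q : Vec n) : ℝ :=
  sInf (curveLength M '' curves X p q)

/-- The Riemann energy, the square of the distance. -/
def energy {n : ℕ} (X : Set (Vec n)) (M : Vec n → Matrix (Fin n) (Fin n) ℝ)
    (p q : Vec n) : ℝ :=
  riemannDist X M p q ^ 2

/-- `c` is a minimizing geodesic from `p` to `q`: a curve in `X` traversed at the constant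
speed `dist(p, q)`, so that its length equals `dist(p, q)`. -/
def IsMinGeodesic {n : ℕ} (X : Set (Vec n)) (M : Vec n → Matrix (Fin n) (Fin n) ℝ)
    (p q : Vec n) (c : ℝ → Vec n) : Prop :=
  c ∈ curves X p q ∧
    ∀ s ∈ Icc (0 : ℝ) 1, √(metricForm M (c s) (velocity c s) (velocity c s)) = riemannDist X M p q

/-! ### The trusted domain -/

/-- The union `D` of the open `r`-balls about the training points. -/
def trustedDomain {n m N : ℕ} (z : Fin N → StateControl n m) (r : ℝ) :
    Set (StateControl n m) :=
  ⋃ i, Metric.ball (z i) r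

/-- The states occurring in `D`. -/
def projState {n m : ℕ} (D : Set (StateControl n m)) : Set (Vec n) :=
  {x | ∃ u : Vec m, pair x u ∈ D}

/-! ### Control contraction metrics and controllers contracting with rate `lam` -/

/-- `-∂_f W + (∂f/∂x W)^ + 2 lam W` with the dual metric `W = M⁻¹`. -/
def strongMatrix {n : ℕ} (f : Vec n → Vec n) (M : Vec n → Matrix (Fin n) (Fin n) ℝ)
    (lam : ℝ) (x : Vec n) : Matrix (Fin n) (Fin n) ℝ :=
  -lieDeriv (fun y => (M y)⁻¹) (f x) x + symHat (jacobian f x * (M x)⁻¹)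
    + (2 * lam) • (M x)⁻¹

/-- `∂_b W - (∂b/∂x W)^` for a vector field `b`, with the dual metric `W = M⁻¹`. -/
def killingMatrix {n : ℕ} (b : Vec n → Vec n) (M : Vec n → Matrix (Fin n) (Fin n) ℝ)
    (x : Vec n) : Matrix (Fin n) (Fin n) ℝ :=
  lieDeriv (fun y => (M y)⁻¹) (b x) x - symHat (jacobian b x * (M x)⁻¹)

/-- The strong CCM conditions at all `x ∈ S`: compressed to the annihilator of `B(x)` (that is,
to the null space of `B(x)ᵀ`, spanned by the columns of `B_⊥(x)`), `strongMatrix` is negative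
semidefinite, and `killingMatrix` vanishes for each column of `B`. -/
def StrongCCM {n m : ℕ} (f : Vec n → Vec n) (B : Vec n → Matrix (Fin n) (Fin m) ℝ)
    (M : Vec n → Matrix (Fin n) (Fin n) ℝ) (lam : ℝ) (S : Set (Vec n)) : Prop :=
  ∀ x ∈ S,
    (∀ η : Fin n → ℝ, (B x)ᵀ *ᵥ η = 0 → η ⬝ᵥ (strongMatrix f M lam x *ᵥ η) ≤ 0) ∧
    (∀ (j : Fin m) (η ζ : Fin n → ℝ), (B x)ᵀ *ᵥ η = 0 → (B x)ᵀ *ᵥ ζ = 0 →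
      η ⬝ᵥ (killingMatrix (column B j) M x *ᵥ ζ) = 0)

/-- The controls `v ∈ U` that satisfy the constraint of the geodesic controller,
`2 c_s(1)ᵀ M(x) (f(x) + B(x) v) - 2 c_s(0)ᵀ M(x⋆) (f(x⋆) + B(x⋆) u⋆) ≤ -2 lam E(x⋆, x)`,
where `c` is a minimizing geodesic from `x⋆` to `x`. -/
def geodesicFeasible {n m : ℕ} (X : Set (Vec n)) (U : Set (Vec m)) (f : Vec n → Vec n)
    (B : Vec n → Matrix (Fin n) (Fin m) ℝ) (M : Vec n → Matrix (Fin n) (Fin n) ℝ)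
    (lam : ℝ) (c : ℝ → Vec n) (xs : Vec n) (us : Vec m) (x : Vec n) : Set (Vec m) :=
  {v | v ∈ U ∧
    2 * metricForm M x (velocity c 1) (affine f B x v)
      - 2 * metricForm M xs (velocity c 0) (affine f B xs us) ≤ -2 * lam * energy X M xs x}

/-- `u` is the output of the optimization-based geodesic controller: a feasible control with
the smallest feedback part `‖u - u⋆‖`. -/
def IsGeodesicControl {n m : ℕ} (X : Set (Vec n)) (U : Set (Vec m)) (f : Vec n → Vec n)
    (B : Vec n → Matrix (Fin n) (Fin m) ℝ) (M : Vec n → Matrix (Fin n) (Fin n) ℝ)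
    (lam : ℝ) (c : ℝ → Vec n) (xs : Vec n) (us : Vec m) (x : Vec n) (u : Vec m) : Prop :=
  u ∈ geodesicFeasible X U f B M lam c xs us x ∧
    ∀ v ∈ geodesicFeasible X U f B M lam c xs us x, ‖u - us‖ ≤ ‖v - us‖

/-- The closed-loop contraction matrix `Ṁ + (M (A + B K))^ + 2 lam M` of the feedback law
`k(x̃, x⋆, u⋆)` at the state `x = x⋆ + x̃`: here `A = ∂f/∂x + ∑ⱼ uʲ ∂Bʲ/∂x` with
`u = k(x - x⋆, x⋆, u⋆)`, `K = ∂k/∂x`, and `Ṁ` is the derivative of `M` along the nominal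
closed-loop dynamics `f(x) + B(x) u`. -/
def weakMatrix {n m : ℕ} (f : Vec n → Vec n) (B : Vec n → Matrix (Fin n) (Fin m) ℝ)
    (M : Vec n → Matrix (Fin n) (Fin n) ℝ) (lam : ℝ) (k : Vec n → Vec n → Vec m → Vec m)
    (xs : Vec n) (us : Vec m) (x : Vec n) : Matrix (Fin n) (Fin n) ℝ :=
  lieDeriv M (affine f B x (k (x - xs) xs us)) x
    + symHat (M x * ((jacobian f x + ∑ j, k (x - xs) xs us j • jacobian (column B j) x)
        + B x * jacobian (fun y => k (y - xs) xs us) x))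
    + (2 * lam) • M x

/-- The feedback law `k(x̃, x⋆, u⋆)` tracks (it returns `u⋆` at zero deviation), is `C¹` in the
state, and satisfies the weak contraction condition `weakMatrix ≺ 0`, for all nominal pairs
`(x⋆, u⋆) ∈ D` and all states `x` of `D`. -/
def WeakCCM {n m : ℕ} (f : Vec n → Vec n) (B : Vec n → Matrix (Fin n) (Fin m) ℝ)
    (M : Vec n → Matrix (Fin n) (Fin n) ℝ) (lam : ℝ) (k : Vec n → Vec n → Vec m → Vec m)
    (D : Set (StateControl n m)) : Prop :=
  ∀ (xs : Vec n) (us : Vec m), pair xs us ∈ D →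
    k 0 xs us = us ∧
    ContDiffOn ℝ 1 (fun x => k (x - xs) xs us) (projState D) ∧
    ∀ x ∈ projState D, ∀ δ : Fin n → ℝ, δ ≠ 0 →
      δ ⬝ᵥ (weakMatrix f B M lam k xs us x *ᵥ δ) < 0

/-! ### The comparison equation -/

/-- The right-hand side of the energy inequality at time `t` and energy `e`,
`-2 (lam - L sqrt (hi / lo)) e
  + 2 sqrt (e hi) minᵢ (L (‖(x⋆(t), u⋆(t)) - (xᵢ, uᵢ)‖ + ufb(t)) + eᵢ)`. -/
def energyRHS {n m N : ℕ} (lam L lo hi : ℝ) (z : Fin N → StateControl n m) (err : Fin N → ℝ)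
    (xs : ℝ → Vec n) (us : ℝ → Vec m) (ufb : ℝ → ℝ) (t e : ℝ) : ℝ :=
  -2 * (lam - L * √(hi / lo)) * e
    + 2 * √(e * hi) * ⨅ i, (L * (‖pair (xs t) (us t) - z i‖ + ufb t) + err i)

/-- `e ≥ 0` solves `ė = F(t, e)`, `e(t₁) = e₀` on `[t₁, t₂]`, in integral form. -/
def IsSolution (F : ℝ → ℝ → ℝ) (t₁ t₂ e₀ : ℝ) (e : ℝ → ℝ) : Prop :=
  ContinuousOn e (Icc t₁ t₂) ∧ (∀ t ∈ Icc t₁ t₂, 0 ≤ e t) ∧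
    ∀ t ∈ Icc t₁ t₂, e t = e₀ + ∫ τ in t₁..t, F τ (e τ)

/-- `e` is the maximal (largest) solution. -/
def IsMaximalSolution (F : ℝ → ℝ → ℝ) (t₁ t₂ e₀ : ℝ) (e : ℝ → ℝ) : Prop :=
  IsSolution F t₁ t₂ e₀ e ∧ ∀ e', IsSolution F t₁ t₂ e₀ e' → ∀ t ∈ Icc t₁ t₂, e' t ≤ e t

end CCM

end

open CCM

namespace CCM
open Filter Topology

/-! Let E(t) be the energy between x⋆(t) and x(t). A minimizing geodesic has constant speed √E, so
the lower eigenvalue bound gives ‖x - x⋆‖ ≤ √(E / lo), and it remains to bound E by the largest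
solution of the comparison equation. Formally Ė ≤ -2 lam E + 2 γ_s(1)ᵀ M(x) d. Cauchy–Schwarz for M
bounds the last term by 2 √E √hi ‖d‖, and replacing the executed pair by the nominal one in the
bound on d costs L (√(E / lo) + ufb). The result is `energyRHS`.

Since E need not be differentiable, the inequality is proved for its upper right Dini derivative. At
a fixed time the geodesic is deformed so that its ends follow x⋆ and x. The energy integral of the
deformed curve bounds E from above and equals E at the start (`energy_le_integral`), so its
derivative bounds the Dini derivative (`energy_eventually_le`). The deformation field is free, and
no geodesic equation is needed: the zero field turns the constraint of the geodesic controller into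
the decay estimate, and the closed-loop field does the same for the feedback law, through
`WeakCCM.firstVariation_le`. A Dini inequality allows comparison only if E has no upward jump when
approached from the left, which is `energy_eventually_le_add`.

The substitution y = √e turns the comparison equation into the linear equation ẏ = -a y + b. The
square of its explicit solution dominates both E and every other solution, by the single comparison
lemma `le_sq_linSol`. -/

/-! ### Comparison with the maximal solution -/

/-- The solution of `ẏ = -a y + b`, `y(t₁) = y₀`. -/
noncomputable def linSol (a : ℝ) (b : ℝ → ℝ) (t₁ y₀ t : ℝ) : ℝ :=
  Real.exp (-a * (t - t₁)) * (y₀ + ∫ τ in t₁..t, Real.exp (a * (τ - t₁)) * b τ)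

theorem hasDerivAt_linSol {a : ℝ} {b : ℝ → ℝ} {t₁ y₀ : ℝ} (hb : Continuous b) (t : ℝ) :
    HasDerivAt (linSol a b t₁ y₀) (-a * linSol a b t₁ y₀ t + b t) t := by
  have hc : Continuous fun τ => Real.exp (a * (τ - t₁)) * b τ := by fun_prop
  have h1 : HasDerivAt (fun t => Real.exp (-a * (t - t₁))) (Real.exp (-a * (t - t₁)) * (-a)) t := by
    have : HasDerivAt (fun t : ℝ => -a * (t - t₁)) (-a) t := by
      simpa using ((hasDerivAt_id t).sub_const t₁).const_mul (-a)
    exact this.exp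
  have h2 : HasDerivAt (fun t => y₀ + ∫ τ in t₁..t, Real.exp (a * (τ - t₁)) * b τ)
      (Real.exp (a * (t - t₁)) * b t) t :=
    (hc.integral_hasStrictDerivAt t₁ t).hasDerivAt.const_add y₀
  refine (h1.mul h2).congr_deriv ?_
  have h3 : Real.exp (-a * (t - t₁)) * Real.exp (a * (t - t₁)) = 1 := by
    rw [← Real.exp_add]; simp
  unfold linSol
  linear_combination b t * h3

theorem continuous_linSol {a : ℝ} {b : ℝ → ℝ} {t₁ y₀ : ℝ} (hb : Continuous b) :
    Continuous (linSol a b t₁ y₀) :=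
  continuous_iff_continuousAt.2 fun t => (hasDerivAt_linSol hb t).continuousAt

theorem linSol_self (a : ℝ) (b : ℝ → ℝ) (t₁ y₀ : ℝ) : linSol a b t₁ y₀ t₁ = y₀ := by
  simp [linSol]

theorem le_linSol {a : ℝ} {b : ℝ → ℝ} {t₁ y₀ t : ℝ} (hb0 : ∀ t, 0 ≤ b t) (ht : t₁ ≤ t) :
    Real.exp (-a * (t - t₁)) * y₀ ≤ linSol a b t₁ y₀ t := by
  unfold linSol
  gcongr
  have : 0 ≤ ∫ τ in t₁..t, Real.exp (a * (τ - t₁)) * b τ :=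
    intervalIntegral.integral_nonneg ht fun τ _ => mul_nonneg (Real.exp_pos _).le (hb0 τ)
  linarith

/-- Affine dependence on the data: the strict supersolutions used in the comparison converge to the
unperturbed solution as ε tends to 0. -/
theorem linSol_add_add {a : ℝ} {b : ℝ → ℝ} {t₁ y₀ t : ℝ} (hb : Continuous b) (ε : ℝ) :
    linSol a (fun τ => b τ + ε) t₁ (y₀ + ε) t =
      linSol a b t₁ y₀ t + ε * linSol a (fun _ => 1) t₁ 1 t := by
  have h1 : Continuous fun τ => Real.exp (a * (τ - t₁)) * b τ := by fun_prop
  have h2 : Continuous fun τ => ε * (Real.exp (a * (τ - t₁)) * 1) := by fun_prop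
  have h : ∫ τ in t₁..t, Real.exp (a * (τ - t₁)) * (b τ + ε) =
      (∫ τ in t₁..t, Real.exp (a * (τ - t₁)) * b τ) +
        ε * ∫ τ in t₁..t, Real.exp (a * (τ - t₁)) * 1 := by
    rw [← intervalIntegral.integral_const_mul,
      ← intervalIntegral.integral_add (h1.intervalIntegrable _ _) (h2.intervalIntegrable _ _)]
    congr 1; ext τ; ring
  unfold linSol
  rw [h]; ring

/-- Induction along a real interval. -/
theorem Icc_induction {p : ℝ → Prop} {t₁ t₂ : ℝ} (h₀ : p t₁)
    (hl : ∀ t ∈ Ioc t₁ t₂, (∀ s ∈ Ico t₁ t, p s) → p t)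
    (hr : ∀ t ∈ Ico t₁ t₂, p t → ∀ᶠ s in 𝓝[>] t, p s) : ∀ t ∈ Icc t₁ t₂, p t := by
  by_contra! hcon
  obtain ⟨t, ht, hpt⟩ := hcon
  set S := {t | t ∈ Icc t₁ t₂ ∧ ¬ p t} with hS
  have hne : S.Nonempty := ⟨t, ht, hpt⟩
  have hbdd : BddBelow S := ⟨t₁, fun s hs => hs.1.1⟩
  set τ := sInf S with hτ
  have hτ1 : t₁ ≤ τ := le_csInf hne fun s hs => hs.1.1
  have hτt : τ ≤ t := csInf_le hbdd ⟨ht, hpt⟩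
  have hbelow : ∀ s ∈ Ico t₁ τ, p s := by
    intro s hs
    by_contra hps
    exact absurd (csInf_le hbdd ⟨⟨hs.1, (hs.2.le.trans hτt).trans ht.2⟩, hps⟩) (not_le.2 hs.2)
  have hpτ : p τ := by
    rcases hτ1.eq_or_lt with h | h
    · rwa [← h]
    · exact hl τ ⟨h, hτt.trans ht.2⟩ hbelow
  have hτt' : τ < t := lt_of_le_of_ne hτt fun h => hpt (h ▸ hpτ)
  have := hr τ ⟨hτ1, hτt'.trans_le ht.2⟩ hpτ
  obtain ⟨v, hv, hsub⟩ := (mem_nhdsGT_iff_exists_Ioo_subset).1 this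
  have hge : v ≤ τ := by
    refine le_csInf hne fun s hs => ?_
    by_contra! hsv
    have h1 : τ ≤ s := csInf_le hbdd hs
    rcases h1.eq_or_lt with h | h
    · exact hs.2 (h ▸ hpτ)
    · exact hs.2 (hsub ⟨h, hsv⟩)
  exact absurd hge (not_le.2 hv)

/-- A nonnegative function that is lower semicontinuous from the left and whose upper right Dini
derivative is at most `-2 a E + 2 √E b` stays below the square of the solution of
`ẏ = -a y + b`. -/
theorem le_sq_linSol {t₁ t₂ a y₀ : ℝ} {b E : ℝ → ℝ} (hb : Continuous b) (hb0 : ∀ t, 0 ≤ b t)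
    (hy₀ : 0 ≤ y₀) (hini : E t₁ ≤ y₀ ^ 2)
    (hleft : ∀ t ∈ Ioc t₁ t₂, ∀ ε > 0, ∀ᶠ s in 𝓝[<] t, E t ≤ E s + ε)
    (hright : ∀ t ∈ Ico t₁ t₂, ∀ G > -2 * a * E t + 2 * √(E t) * b t,
      ∀ᶠ s in 𝓝[>] t, E s ≤ E t + (s - t) * G) :
    ∀ t ∈ Icc t₁ t₂, E t ≤ linSol a b t₁ y₀ t ^ 2 := by
  -- Raising both b and y₀ by ε makes y positive and y² a strict supersolution, so contact is
  -- followed by strict separation.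
  have key : ∀ ε > 0, ∀ t ∈ Icc t₁ t₂,
      E t ≤ linSol a (fun τ => b τ + ε) t₁ (y₀ + ε) t ^ 2 := by
    intro ε hε
    set y := linSol a (fun τ => b τ + ε) t₁ (y₀ + ε) with hy
    have hbε : Continuous fun τ => b τ + ε := by fun_prop
    have hycont : Continuous fun t => y t ^ 2 := (continuous_linSol hbε).pow 2
    have hyder : ∀ t, HasDerivAt (fun t => y t ^ 2) (2 * y t * (-a * y t + (b t + ε))) t := by
      intro t
      simpa using (hasDerivAt_linSol (a := a) (t₁ := t₁) (y₀ := y₀ + ε) hbε t).fun_pow 2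
    have hypos : ∀ t, t₁ ≤ t → 0 < y t := fun t ht =>
      lt_of_lt_of_le (mul_pos (Real.exp_pos _) (by linarith))
        (le_linSol (fun t => by linarith [hb0 t]) ht)
    refine Icc_induction ?_ ?_ ?_
    · rw [hy, linSol_self]; nlinarith
    · intro t ht hs
      refine le_of_forall_pos_le_add fun η hη => ?_
      have h1 := hleft t ht (η / 2) (by linarith)
      have h2 : ∀ᶠ s in 𝓝[<] t, y s ^ 2 < y t ^ 2 + η / 2 :=
        (hycont.continuousAt.mono_left nhdsWithin_le_nhds).eventually_lt_const (by linarith)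
      have h3 : ∀ᶠ s in 𝓝[<] t, s ∈ Ico t₁ t :=
        Ico_mem_nhdsLT ht.1
      obtain ⟨s, h1, h2, h3⟩ := (h1.and (h2.and h3)).exists
      have := hs s h3
      linarith
    · intro t ht hle
      -- At a contact point √E = y, and the slope of y² exceeds the Dini bound by 2 y ε, which
      -- leaves room for G. If the inequality is strict, continuity of y² suffices.
      rcases hle.eq_or_lt with heq | hlt
      · have hyt := hypos t ht.1
        have hsq : √(E t) = y t := by rw [heq, Real.sqrt_sq hyt.le]
        obtain ⟨G, hG1, hG2⟩ : ∃ G, -2 * a * E t + 2 * √(E t) * b t < G ∧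
            G < 2 * y t * (-a * y t + (b t + ε)) := by
          apply exists_between
          rw [hsq, heq]
          nlinarith [mul_pos hyt hε]
        have h1 := hright t ht G hG1
        have h2 := (hasDerivWithinAt_iff_tendsto_slope' (by simp)).1
          ((hyder t).hasDerivWithinAt (s := Ioi t)) |>.eventually_const_lt hG2
        filter_upwards [h1, h2, self_mem_nhdsWithin] with s h1 h2 h3
        have hst : 0 < s - t := sub_pos.2 h3
        rw [slope_def_field, lt_div_iff₀ hst] at h2
        linarith
      · set G := -2 * a * E t + 2 * √(E t) * b t + 1
        have h1 := hright t ht G (by simp [G])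
        have h2 : ∀ᶠ s in 𝓝[>] t, E t + (s - t) * G < y s ^ 2 := by
          refine Filter.Eventually.filter_mono nhdsWithin_le_nhds ?_
          have hc1 : ContinuousAt (fun s => E t + (s - t) * G) t := by fun_prop
          exact hc1.eventually_lt hycont.continuousAt (by simpa using hlt)
        filter_upwards [h1, h2] with s h1 h2
        exact h1.trans h2.le
  intro t ht
  have hlim : Tendsto (fun ε : ℝ => linSol a (fun τ => b τ + ε) t₁ (y₀ + ε) t ^ 2) (𝓝[>] 0)
      (𝓝 (linSol a b t₁ y₀ t ^ 2)) := by
    simp only [linSol_add_add hb]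
    have : Continuous fun ε : ℝ =>
      (linSol a b t₁ y₀ t + ε * linSol a (fun _ => 1) t₁ 1 t) ^ 2 := by fun_prop
    simpa using (this.tendsto 0).mono_left nhdsWithin_le_nhds
  exact ge_of_tendsto hlim (by filter_upwards [self_mem_nhdsWithin] with ε hε using key ε hε t ht)

/-- The integrand is extended by constants to a continuous function on the line, so the fundamental
theorem of calculus applies also at the left end point. -/
theorem IsSolution.hasDerivWithinAt {F : ℝ → ℝ → ℝ} {t₁ t₂ e₀ : ℝ} {e : ℝ → ℝ} (ht : t₁ ≤ t₂)
    (he : IsSolution F t₁ t₂ e₀ e) (hF : ContinuousOn (fun t => F t (e t)) (Icc t₁ t₂))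
    {t : ℝ} (htt : t ∈ Ico t₁ t₂) : HasDerivWithinAt e (F t (e t)) (Ici t) t := by
  set g : ℝ → ℝ := IccExtend ht (domRestrict (Icc t₁ t₂) fun t => F t (e t)) with hg
  have hgc : Continuous g := (continuousOn_iff_continuous_domRestrict.1 hF).Icc_extend'
  have hgt : ∀ s ∈ Icc t₁ t₂, g s = F s (e s) := fun s hs => by
    rw [hg, IccExtend_of_mem _ _ hs]; rfl
  have hd : HasDerivAt (fun t => e₀ + ∫ τ in t₁..t, g τ) (g t) t :=
    (hgc.integral_hasStrictDerivAt t₁ t).hasDerivAt.const_add e₀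
  rw [← hgt t ⟨htt.1, htt.2.le⟩]
  have heq : ∀ s ∈ Icc t₁ t₂, e s = e₀ + ∫ τ in t₁..s, g τ := by
    intro s hs
    rw [he.2.2 s hs]
    congr 1
    refine intervalIntegral.integral_congr fun τ hτ => ?_
    rw [uIcc_of_le hs.1] at hτ
    exact (hgt τ ⟨hτ.1, hτ.2.trans hs.2⟩).symm
  refine hd.hasDerivWithinAt.congr_of_eventuallyEq ?_ (heq t ⟨htt.1, htt.2.le⟩)
  filter_upwards [Icc_mem_nhdsGE htt.2] with s hs
  exact heq s ⟨htt.1.trans hs.1, hs.2⟩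

/-! ### The Bernoulli equation ė = -2 a e + 2 √e b and its linearization -/

section Bernoulli

variable {F : ℝ → ℝ → ℝ} {t₁ t₂ a E₁ : ℝ} {b : ℝ → ℝ}

theorem continuousOn_of_bernoulli (hb : Continuous b)
    (hF : ∀ t ∈ Icc t₁ t₂, ∀ e, 0 ≤ e → F t e = -2 * a * e + 2 * √e * b t)
    {e : ℝ → ℝ} (hec : ContinuousOn e (Icc t₁ t₂)) (he0 : ∀ t ∈ Icc t₁ t₂, 0 ≤ e t) :
    ContinuousOn (fun t => F t (e t)) (Icc t₁ t₂) := by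
  have : ContinuousOn (fun t => -2 * a * e t + 2 * √(e t) * b t) (Icc t₁ t₂) := by fun_prop
  exact this.congr fun t ht => hF t ht _ (he0 t ht)

theorem isSolution_sq_linSol (hb : Continuous b) (hb0 : ∀ t, 0 ≤ b t)
    (hF : ∀ t ∈ Icc t₁ t₂, ∀ e, 0 ≤ e → F t e = -2 * a * e + 2 * √e * b t) (hE₁ : 0 ≤ E₁) :
    IsSolution F t₁ t₂ E₁ (fun t => linSol a b t₁ (√E₁) t ^ 2) := by
  have hyc : Continuous (linSol a b t₁ (√E₁)) := continuous_linSol hb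
  refine ⟨by fun_prop, fun t _ => sq_nonneg _, fun t htt => ?_⟩
  have hpos : ∀ τ, t₁ ≤ τ → 0 ≤ linSol a b t₁ (√E₁) τ := fun τ hτ =>
    le_trans (by positivity) (le_linSol hb0 hτ)
  have h1 : ∫ τ in t₁..t, F τ (linSol a b t₁ (√E₁) τ ^ 2) =
      ∫ τ in t₁..t, 2 * linSol a b t₁ (√E₁) τ * (-a * linSol a b t₁ (√E₁) τ + b τ) := by
    refine intervalIntegral.integral_congr fun τ hτ => ?_
    rw [uIcc_of_le htt.1] at hτ
    rw [hF τ ⟨hτ.1, hτ.2.trans htt.2⟩ _ (sq_nonneg _), Real.sqrt_sq (hpos τ hτ.1)]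
    ring
  have h2 : ∀ τ ∈ uIcc t₁ t, HasDerivAt (fun t => linSol a b t₁ (√E₁) t ^ 2)
      (2 * linSol a b t₁ (√E₁) τ * (-a * linSol a b t₁ (√E₁) τ + b τ)) τ := by
    intro τ _
    simpa using (hasDerivAt_linSol (a := a) (t₁ := t₁) (y₀ := √E₁) hb τ).fun_pow 2
  rw [h1, intervalIntegral.integral_eq_sub_of_hasDerivAt h2
    (Continuous.intervalIntegrable (by fun_prop) _ _), linSol_self, Real.sq_sqrt hE₁]
  ring

/-- A competing solution is continuous and has the right-hand side as its right derivative, so it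
satisfies the hypotheses of `le_sq_linSol`. -/
theorem isMaximalSolution_sq_linSol (ht : t₁ ≤ t₂) (hb : Continuous b) (hb0 : ∀ t, 0 ≤ b t)
    (hF : ∀ t ∈ Icc t₁ t₂, ∀ e, 0 ≤ e → F t e = -2 * a * e + 2 * √e * b t) (hE₁ : 0 ≤ E₁) :
    IsMaximalSolution F t₁ t₂ E₁ (fun t => linSol a b t₁ (√E₁) t ^ 2) := by
  refine ⟨isSolution_sq_linSol hb hb0 hF hE₁, fun e he => ?_⟩
  refine le_sq_linSol hb hb0 (Real.sqrt_nonneg _) ?_ ?_ ?_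
  · rw [he.2.2 t₁ ⟨le_rfl, ht⟩, Real.sq_sqrt hE₁]; simp
  · intro t htt ε hε
    have h1 : Tendsto e (𝓝[<] t) (𝓝 (e t)) := by
      have := (he.1 t ⟨htt.1.le, htt.2⟩).tendsto
      refine this.mono_left ?_
      rw [← nhdsWithin_Ico_eq_nhdsLT htt.1]
      exact nhdsWithin_mono _ fun s hs => ⟨hs.1, hs.2.le.trans htt.2⟩
    filter_upwards [h1.eventually_const_lt (sub_lt_self (e t) hε)] with s hs
    linarith
  · intro t htt G hG
    have hd := he.hasDerivWithinAt ht (continuousOn_of_bernoulli hb hF he.1 he.2.1) htt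
    have htI : t ∈ Icc t₁ t₂ := ⟨htt.1, htt.2.le⟩
    rw [hF t htI _ (he.2.1 t htI)] at hd
    have h2 := (hasDerivWithinAt_iff_tendsto_slope' (by simp)).1
      (hd.mono Ioi_subset_Ici_self) |>.eventually_lt_const hG
    filter_upwards [h2, self_mem_nhdsWithin] with s h2 h3
    have hst : 0 < s - t := sub_pos.2 h3
    rw [slope_def_field, div_lt_iff₀ hst] at h2
    linarith

/-- Uniqueness can fail only at e = 0, where the square root is not Lipschitz. A solution starting
at a positive value stays positive, so √e is differentiable from the right and solves the linear
equation. -/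
theorem eqOn_sq_linSol (ht : t₁ ≤ t₂) (hb : Continuous b) (hb0 : ∀ t, 0 ≤ b t)
    (hF : ∀ t ∈ Icc t₁ t₂, ∀ e, 0 ≤ e → F t e = -2 * a * e + 2 * √e * b t) (hE₁ : 0 < E₁)
    {e : ℝ → ℝ} (he : IsSolution F t₁ t₂ E₁ e) :
    EqOn e (fun t => linSol a b t₁ (√E₁) t ^ 2) (Icc t₁ t₂) := by
  have hd : ∀ t ∈ Ico t₁ t₂,
      HasDerivWithinAt e (-2 * a * e t + 2 * √(e t) * b t) (Ici t) t := by
    intro t htt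
    have htI : t ∈ Icc t₁ t₂ := ⟨htt.1, htt.2.le⟩
    have := he.hasDerivWithinAt ht (continuousOn_of_bernoulli hb hF he.1 he.2.1) htt
    rwa [hF t htI _ (he.2.1 t htI)] at this
  have hini : e t₁ = E₁ := by rw [he.2.2 t₁ ⟨le_rfl, ht⟩]; simp
  have hexp : ∀ c t, HasDerivAt (fun t => Real.exp (c * (t - t₁)))
      (Real.exp (c * (t - t₁)) * c) t := by
    intro c t
    have : HasDerivAt (fun t : ℝ => c * (t - t₁)) c t := by
      simpa using ((hasDerivAt_id t).sub_const t₁).const_mul c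
    exact this.exp
  have hec := he.1
  have hpos : ∀ t ∈ Icc t₁ t₂, 0 < e t := by
    intro t htt
    -- The integrating factor cancels -2 a e and leaves the nonnegative derivative 2 √e b exp(2 a (t
    -- - t₁)), so the product never falls below E₁.
    have hle : -(e t * Real.exp (2 * a * (t - t₁))) ≤ -E₁ := by
      refine image_le_of_deriv_right_le_deriv_boundary
        (f := fun t => -(e t * Real.exp (2 * a * (t - t₁)))) (B := fun _ => -E₁)
        (B' := fun _ => 0) (f' := fun t => -((-2 * a * e t + 2 * √(e t) * b t) *
          Real.exp (2 * a * (t - t₁)) + e t * (Real.exp (2 * a * (t - t₁)) * (2 * a))))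
        (by fun_prop) ?_ (by simp [hini]) continuousOn_const ?_ ?_ htt
      · intro s hs
        exact ((hd s hs).mul (hexp (2 * a) s).hasDerivWithinAt).neg
      · intro s _
        exact (hasDerivAt_const s (-E₁)).hasDerivWithinAt
      · intro s hs
        have : 0 ≤ √(e s) * b s * Real.exp (2 * a * (s - t₁)) :=
          mul_nonneg (mul_nonneg (Real.sqrt_nonneg _) (hb0 s)) (Real.exp_pos _).le
        nlinarith
    have h1 : 0 < e t * Real.exp (2 * a * (t - t₁)) := by linarith
    exact pos_of_mul_pos_left h1 (Real.exp_pos _).le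
  -- The difference of two solutions of the linear equation is a multiple of exp(-a (t - t₁)); the
  -- multiple is zero because the initial values agree.
  have hconst : ∀ t ∈ Icc t₁ t₂, Real.exp (a * (t - t₁)) * (√(e t) - linSol a b t₁ (√E₁) t) =
      Real.exp (a * (t₁ - t₁)) * (√(e t₁) - linSol a b t₁ (√E₁) t₁) := by
    have hyc : Continuous (linSol a b t₁ (√E₁)) := continuous_linSol hb
    refine constant_of_has_deriv_right_zero
      (f := fun t => Real.exp (a * (t - t₁)) * (√(e t) - linSol a b t₁ (√E₁) t))
      (by fun_prop) fun t htt => ?_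
    have hp := hpos t ⟨htt.1, htt.2.le⟩
    refine ((hexp a t).hasDerivWithinAt.mul
      (((hd t htt).sqrt hp.ne').sub (hasDerivAt_linSol hb t).hasDerivWithinAt)).congr_deriv ?_
    have hs : 0 < √(e t) := Real.sqrt_pos.2 hp
    have : (-2 * a * e t + 2 * √(e t) * b t) / (2 * √(e t)) = -a * √(e t) + b t := by
      rw [div_eq_iff (by positivity)]
      linear_combination 2 * a * Real.mul_self_sqrt hp.le
    rw [this]; simp only [Pi.sub_apply]; ring
  intro t htt
  have h := hconst t htt
  rw [hini, linSol_self, sub_self (√E₁), mul_zero, mul_eq_zero] at h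
  have h' := h.resolve_left (Real.exp_pos _).ne'
  simp only
  rw [← sub_eq_zero.1 h', Real.sq_sqrt (hpos t htt).le]

end Bernoulli


/-! ### The metric at a point -/

section Metric

variable {n : ℕ} {M : Vec n → Matrix (Fin n) (Fin n) ℝ} {x : Vec n}

theorem metricForm_eq_sum (δ η : Vec n) :
    metricForm M x δ η = ∑ i, ∑ j, δ i * (M x i j * η j) := by
  simp [metricForm, dotProduct, Matrix.mulVec, Finset.mul_sum]

theorem metricForm_add_left (δ δ' η : Vec n) :
    metricForm M x (δ + δ') η = metricForm M x δ η + metricForm M x δ' η := by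
  simp [metricForm, add_dotProduct]

theorem metricForm_add_right (δ η η' : Vec n) :
    metricForm M x δ (η + η') = metricForm M x δ η + metricForm M x δ η' := by
  simp [metricForm, Matrix.mulVec_add, dotProduct_add]

theorem metricForm_smul_left (c : ℝ) (δ η : Vec n) :
    metricForm M x (c • δ) η = c * metricForm M x δ η := by
  simp [metricForm]

theorem metricForm_smul_right (c : ℝ) (δ η : Vec n) :
    metricForm M x δ (c • η) = c * metricForm M x δ η := by
  simp [metricForm, Matrix.mulVec_smul]

theorem metricForm_comm (hM : (M x).PosDef) (δ η : Vec n) :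
    metricForm M x δ η = metricForm M x η δ := by
  have h : (M x)ᵀ = M x := by simpa [Matrix.IsHermitian] using hM.isHermitian
  unfold metricForm
  rw [Matrix.dotProduct_mulVec, dotProduct_comm, ← Matrix.mulVec_transpose, h]

theorem metricForm_self_nonneg (hM : (M x).PosDef) (δ : Vec n) : 0 ≤ metricForm M x δ δ := by
  simpa [metricForm] using hM.posSemidef.dotProduct_mulVec_nonneg δ.ofLp

/-- Cauchy–Schwarz from the discriminant of the nonnegative quadratic s ↦ ⟨δ + s η, δ + s η⟩. -/
theorem metricForm_le_mul_sqrt (hM : (M x).PosDef) (δ η : Vec n) :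
    metricForm M x δ η ≤ √(metricForm M x δ δ) * √(metricForm M x η η) := by
  rw [← Real.sqrt_mul (metricForm_self_nonneg hM δ)]
  refine Real.le_sqrt_of_sq_le ?_
  have h : ∀ s : ℝ, 0 ≤ metricForm M x η η * (s * s) + 2 * metricForm M x δ η * s +
      metricForm M x δ δ := by
    intro s
    have := metricForm_self_nonneg hM (δ + s • η)
    simp only [metricForm_add_left, metricForm_add_right, metricForm_smul_left,
      metricForm_smul_right, metricForm_comm hM η δ] at this
    linarith
  have := discrim_le_zero h
  unfold discrim at this
  linarith

theorem dotProduct_ofLp_self (v : Vec n) : v.ofLp ⬝ᵥ v.ofLp = ‖v‖ ^ 2 := by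
  rw [EuclideanSpace.norm_sq_eq]
  simp [dotProduct, sq]

/-- An eigenvalue of M - minEig · 1, shifted back by minEig, lies in the spectrum of M. It is
therefore nonnegative, and the shifted matrix is positive semidefinite. -/
theorem minEig_mul_le (hM : (M x).PosDef) (v : Vec n) :
    minEig (M x) * ‖v‖ ^ 2 ≤ metricForm M x v v := by
  have hfin : (spectrum ℝ (M x)).Finite := Matrix.finite_real_spectrum
  have hH : (M x - minEig (M x) • 1).IsHermitian :=
    hM.isHermitian.sub (by simp [Matrix.IsHermitian])
  have hps : (M x - minEig (M x) • 1).PosSemidef := by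
    rw [hH.posSemidef_iff_eigenvalues_nonneg]
    intro i
    have h1 := hH.eigenvalues_mem_spectrum_real i
    have h2 : minEig (M x) + hH.eigenvalues i ∈ spectrum ℝ (M x) := by
      rw [spectrum.mem_iff] at h1 ⊢
      convert h1 using 2
      simp only [Algebra.algebraMap_eq_smul_one, add_smul]
      abel
    have h3 := csInf_le hfin.bddBelow h2
    change minEig (M x) ≤ _ at h3
    simpa using h3
  have := hps.dotProduct_mulVec_nonneg v.ofLp
  simp only [star_trivial, Matrix.sub_mulVec, dotProduct_sub, Matrix.smul_mulVec,
    Matrix.one_mulVec, dotProduct_smul, dotProduct_ofLp_self, smul_eq_mul] at this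
  unfold metricForm
  linarith

theorem le_maxEig_mul (hM : (M x).PosDef) (v : Vec n) :
    metricForm M x v v ≤ maxEig (M x) * ‖v‖ ^ 2 := by
  have hfin : (spectrum ℝ (M x)).Finite := Matrix.finite_real_spectrum
  have hH : (maxEig (M x) • 1 - M x).IsHermitian :=
    Matrix.IsHermitian.sub (by simp [Matrix.IsHermitian]) hM.isHermitian
  have hps : (maxEig (M x) • 1 - M x).PosSemidef := by
    rw [hH.posSemidef_iff_eigenvalues_nonneg]
    intro i
    have h1 := hH.eigenvalues_mem_spectrum_real i
    have h2 : maxEig (M x) - hH.eigenvalues i ∈ spectrum ℝ (M x) := by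
      rw [spectrum.mem_iff, ← IsUnit.neg_iff] at h1 ⊢
      rw [IsUnit.neg_iff] at h1
      convert h1 using 2
      simp only [Algebra.algebraMap_eq_smul_one, sub_smul]
      abel
    have h3 := le_csSup hfin.bddAbove h2
    change _ ≤ maxEig (M x) at h3
    simpa using h3
  have := hps.dotProduct_mulVec_nonneg v.ofLp
  simp only [star_trivial, Matrix.sub_mulVec, dotProduct_sub, Matrix.smul_mulVec,
    Matrix.one_mulVec, dotProduct_smul, dotProduct_ofLp_self, smul_eq_mul] at this
  unfold metricForm
  linarith

variable {S : Set (Vec n)}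

theorem infMinEig_mul_le (hM : ∀ x ∈ S, (M x).PosDef) (hx : x ∈ S) (v : Vec n) :
    infMinEig M S * ‖v‖ ^ 2 ≤ metricForm M x v v := by
  refine le_trans ?_ (minEig_mul_le (hM x hx) v)
  gcongr
  -- Positive semidefiniteness supplies the lower bound 0 that makes the real infimum a genuine one.
  refine csInf_le ⟨0, ?_⟩ ⟨x, hx, rfl⟩
  rintro _ ⟨y, hy, rfl⟩
  refine Real.sInf_nonneg fun c hc => ?_
  exact ((hM y hy).posSemidef.isHermitian.spectrum_real_eq_range_eigenvalues ▸ hc).elim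
    fun i hi => hi ▸ (hM y hy).posSemidef.eigenvalues_nonneg i

theorem sqrt_metricForm_le (hM : ∀ x ∈ S, (M x).PosDef)
    (hhi : BddAbove ((fun x => maxEig (M x)) '' S)) (hx : x ∈ S) (v : Vec n) :
    √(metricForm M x v v) ≤ √(supMaxEig M S) * ‖v‖ := by
  have h : metricForm M x v v ≤ supMaxEig M S * ‖v‖ ^ 2 := by
    refine (le_maxEig_mul (hM x hx) v).trans ?_
    gcongr
    exact le_csSup hhi ⟨x, hx, rfl⟩
  refine (Real.sqrt_le_sqrt h).trans_eq ?_
  rw [Real.sqrt_mul' _ (sq_nonneg _), Real.sqrt_sq (norm_nonneg _)]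

theorem norm_le_of_sqrt_metricForm (hM : ∀ x ∈ S, (M x).PosDef) (hlo : 0 < infMinEig M S)
    (hx : x ∈ S) (v : Vec n) :
    ‖v‖ ≤ √(metricForm M x v v) / √(infMinEig M S) := by
  rw [← Real.sqrt_div' _ hlo.le]
  refine Real.le_sqrt_of_sq_le ?_
  rw [le_div_iff₀ hlo, mul_comm]
  exact infMinEig_mul_le hM hx v

end Metric


/-! ### Integrals over `[0,1]` depending on a parameter -/

section Parametric

variable {E P : Type*} [NormedAddCommGroup E] [NormedSpace ℝ E] [NormedAddCommGroup P]
  [NormedSpace ℝ P] {G : E → ℝ} {O : Set E} {Γ : ℝ → E} {A : ℝ → P →L[ℝ] E}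

/-- Small affine perturbations of a compact arc in an open set stay in it. -/
theorem eventually_forall_mem_of_isOpen (hO : IsOpen O) (hΓ : ContinuousOn Γ (Icc 0 1))
    (hΓO : ∀ s ∈ Icc (0 : ℝ) 1, Γ s ∈ O) (hA : ContinuousOn A (Icc 0 1)) :
    ∀ᶠ θ : P in 𝓝 0, ∀ s ∈ Icc (0 : ℝ) 1, Γ s + A s θ ∈ O := by
  obtain ⟨δ, hδ, hsub⟩ := (isCompact_Icc.image_of_continuousOn hΓ).exists_thickening_subset_open hO
    (image_subset_iff.2 hΓO)
  obtain ⟨C, hC⟩ := isCompact_Icc.exists_bound_of_continuousOn hA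
  have hC0 : 0 ≤ C := (norm_nonneg _).trans (hC 0 (by simp))
  have : ∀ᶠ θ : P in 𝓝 0, C * ‖θ‖ < δ := by
    have hc : ContinuousAt (fun θ : P => C * ‖θ‖) 0 := by fun_prop
    exact hc.eventually_lt_const (by simpa using hδ)
  filter_upwards [this] with θ hθ s hs
  refine hsub (Metric.mem_thickening_iff.2 ⟨Γ s, mem_image_of_mem _ hs, ?_⟩)
  rw [dist_eq_norm, add_sub_cancel_left]
  refine lt_of_le_of_lt ((A s).le_opNorm θ |>.trans ?_) hθ
  gcongr
  exact hC s hs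

theorem hasFDerivAt_integral_affine (hO : IsOpen O) (hG : ContDiffOn ℝ 1 G O)
    (hΓ : ContinuousOn Γ (Icc 0 1)) (hΓO : ∀ s ∈ Icc (0 : ℝ) 1, Γ s ∈ O)
    (hA : ContinuousOn A (Icc 0 1)) :
    HasFDerivAt (fun θ => ∫ s in (0 : ℝ)..1, G (Γ s + A s θ))
      (∫ s in (0 : ℝ)..1, (fderiv ℝ G (Γ s)).comp (A s)) 0 := by
  have hG' : ContinuousOn (fderiv ℝ G) O := hG.continuousOn_fderiv_of_isOpen hO le_rfl
  have hGΓ : ContinuousOn (fun s => fderiv ℝ G (Γ s)) (Icc 0 1) := hG'.comp hΓ hΓO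
  obtain ⟨C, hC⟩ := isCompact_Icc.exists_bound_of_continuousOn hGΓ
  obtain ⟨CA, hCA⟩ := isCompact_Icc.exists_bound_of_continuousOn hA
  have hC0 : 0 ≤ C := (norm_nonneg _).trans (hC 0 (by simp))
  -- Near the compact arc the derivative of G is bounded by C + 1; staying in this smaller open set
  -- provides the dominating constant.
  set V := O ∩ (fun x => ‖fderiv ℝ G x‖) ⁻¹' Iio (C + 1)
  have hV : IsOpen V := hG'.norm.isOpen_inter_preimage hO isOpen_Iio
  have hev := eventually_forall_mem_of_isOpen hV hΓ
    (fun s hs => ⟨hΓO s hs, lt_of_le_of_lt (hC s hs) (lt_add_one C)⟩) hA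
  have hsub : uIoc (0 : ℝ) 1 ⊆ Icc 0 1 := by
    rw [uIoc_of_le zero_le_one]; exact Ioc_subset_Icc_self
  have hcont : ∀ θ : P, (∀ s ∈ Icc (0 : ℝ) 1, Γ s + A s θ ∈ V) →
      ContinuousOn (fun s => G (Γ s + A s θ)) (Icc 0 1) := fun θ hθ =>
    hG.continuousOn.comp (hΓ.add (hA.clm_apply continuousOn_const)) fun s hs => (hθ s hs).1
  have h0 : ∀ s ∈ Icc (0 : ℝ) 1, Γ s + A s 0 ∈ V := hev.self_of_nhds
  have key := intervalIntegral.hasFDerivAt_integral_of_dominated_of_fderiv_le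
    (μ := volume) (a := 0) (b := 1) (x₀ := (0 : P))
    (F := fun θ s => G (Γ s + A s θ)) (F' := fun θ s => (fderiv ℝ G (Γ s + A s θ)).comp (A s))
    (bound := fun _ => (C + 1) * CA) hev ?_ ?_ ?_ ?_ (by simp) ?_
  · simpa using key
  · filter_upwards [hev] with θ hθ
    exact ((hcont θ hθ).mono hsub).aestronglyMeasurable measurableSet_uIoc
  · exact ContinuousOn.intervalIntegrable (by rw [uIcc_of_le zero_le_one]; exact hcont 0 h0)
  · simp only [map_zero, add_zero]
    exact ((hGΓ.clm_comp hA).mono hsub).aestronglyMeasurable measurableSet_uIoc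
  · refine Eventually.of_forall fun s hs θ hθ => ?_
    refine (ContinuousLinearMap.opNorm_comp_le _ _).trans ?_
    exact mul_le_mul (hθ s (hsub hs)).2.le (hCA s (hsub hs)) (norm_nonneg _) (by linarith)
  · refine Eventually.of_forall fun s hs θ hθ => ?_
    have hd : DifferentiableAt ℝ G (Γ s + A s θ) :=
      (hG.differentiableOn one_ne_zero).differentiableAt (hO.mem_nhds (hθ s (hsub hs)).1)
    exact hd.hasFDerivAt.comp θ ((A s).hasFDerivAt.const_add (Γ s))

end Parametric

/-- The densities `(k + 1) s ^ k` on `[0,1]` concentrate at `1`. -/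
theorem tendsto_integral_pow_mul_one {g : ℝ → ℝ} (hg : ContinuousOn g (Icc 0 1)) :
    Tendsto (fun k : ℕ => ((k : ℝ) + 1) * ∫ s in (0 : ℝ)..1, s ^ k * g s) atTop (𝓝 (g 1)) := by
  have h := tendsto_setIntegral_pow_smul_of_unique_maximum_of_isCompact_of_continuousOn
    (μ := (volume : Measure ℝ)) (s := Icc (0 : ℝ) 1) (c := fun s => s) (x₀ := 1) (g := g)
    isCompact_Icc continuousOn_id (fun y hy h => lt_of_le_of_ne hy.2 h) (fun y hy => hy.1)
    one_pos (by rw [interior_Icc, closure_Ioo (by norm_num)]; simp) hg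
  refine h.congr fun k => ?_
  rw [integral_Icc_eq_integral_Ioc, integral_Icc_eq_integral_Ioc,
    ← intervalIntegral.integral_of_le zero_le_one, ← intervalIntegral.integral_of_le zero_le_one,
    integral_pow]
  simp

theorem tendsto_integral_pow_mul_zero {g : ℝ → ℝ} (hg : ContinuousOn g (Icc 0 1)) :
    Tendsto (fun k : ℕ => ((k : ℝ) + 1) * ∫ s in (0 : ℝ)..1, (1 - s) ^ k * g s) atTop
      (𝓝 (g 0)) := by
  have hg' : ContinuousOn (fun s => g (1 - s)) (Icc 0 1) :=
    hg.comp (by fun_prop) fun s hs => ⟨by linarith [hs.2], by linarith [hs.1]⟩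
  have h := tendsto_integral_pow_mul_one hg'
  simp only [sub_self] at h
  refine h.congr fun k => ?_
  have := intervalIntegral.integral_comp_sub_left (a := 0) (b := 1)
    (fun s => (1 - s) ^ k * g s) (1 : ℝ)
  simp only [sub_sub_cancel, sub_self, sub_zero] at this
  rw [this]

/-- Used for the position part of the end point perturbations: it lacks the factor k + 1 of the
velocity part and so disappears in the limit. -/
theorem tendsto_zero_of_tendsto_succ_mul {u : ℕ → ℝ} {l : ℝ}
    (h : Tendsto (fun k : ℕ => ((k : ℝ) + 1) * u k) atTop (𝓝 l)) : Tendsto u atTop (𝓝 0) := by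
  have := tendsto_one_div_add_atTop_nhds_zero_nat.mul h
  rw [zero_mul] at this
  refine this.congr fun k => ?_
  have : (k : ℝ) + 1 ≠ 0 := by positivity
  field_simp

/-! ### First variation of the energy -/

section Variation

variable {n : ℕ} {X : Set (Vec n)} {M : Vec n → Matrix (Fin n) (Fin n) ℝ}

/-- The energy density `vᵀ M(x) v` as a function on the tangent bundle. -/
noncomputable def energyDensity (M : Vec n → Matrix (Fin n) (Fin n) ℝ) (z : Vec n × Vec n) : ℝ :=
  metricForm M z.1 z.2 z.2

theorem contDiffOn_energyDensity (hM : MatrixC1On M X) :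
    ContDiffOn ℝ 1 (energyDensity M) (X ×ˢ univ) := by
  unfold energyDensity
  simp only [metricForm_eq_sum]
  refine ContDiffOn.sum fun i _ => ContDiffOn.sum fun j _ => ?_
  have h1 : ∀ i, ContDiffOn ℝ 1 (fun z : Vec n × Vec n => z.2 i) (X ×ˢ univ) := fun i => by
    have : ContDiff ℝ 1 (fun z : Vec n × Vec n => z.2 i) := by fun_prop
    exact this.contDiffOn
  exact (h1 i).mul (((hM i j).comp contDiff_fst.contDiffOn fun z hz => hz.1).mul (h1 j))

/-- Computed as a derivative along the line in direction (a, w). Symmetry of M merges the two terms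
containing w. -/
theorem fderiv_energyDensity (hX : IsOpen X) (hM : MatrixC1On M X) {p : Vec n} (hp : p ∈ X)
    (hMp : (M p).PosDef) (v a w : Vec n) :
    fderiv ℝ (energyDensity M) (p, v) (a, w) =
      v.ofLp ⬝ᵥ (lieDeriv M a p *ᵥ v.ofLp) + 2 * metricForm M p v w := by
  have hO : IsOpen (X ×ˢ (univ : Set (Vec n))) := hX.prod isOpen_univ
  have hd : DifferentiableAt ℝ (energyDensity M) (p, v) :=
    ((contDiffOn_energyDensity hM).differentiableOn one_ne_zero).differentiableAt
      (hO.mem_nhds ⟨hp, mem_univ _⟩)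
  have h1 : HasDerivAt (fun τ : ℝ => energyDensity M ((p, v) + τ • (a, w)))
      (fderiv ℝ (energyDensity M) (p, v) (a, w)) 0 := by
    have := hd.hasFDerivAt.hasLineDerivAt (a, w)
    exact this
  have hline : ∀ i, HasDerivAt (fun τ : ℝ => (v + τ • w) i) (w i) 0 := fun i => by
    have : HasDerivAt (fun τ : ℝ => v i + τ * w i) (1 * w i) 0 :=
      ((hasDerivAt_id (0 : ℝ)).mul_const (w i)).const_add (v i)
    simpa using this
  have hMd : ∀ i j, HasDerivAt (fun τ : ℝ => M (p + τ • a) i j)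
      (fderiv ℝ (fun z => M z i j) p a) 0 := fun i j => by
    have hd : DifferentiableAt ℝ (fun z => M z i j) p :=
      ((hM i j).differentiableOn one_ne_zero).differentiableAt (hX.mem_nhds hp)
    exact hd.hasFDerivAt.hasLineDerivAt a
  have h2 : HasDerivAt (fun τ : ℝ => energyDensity M ((p, v) + τ • (a, w)))
      (∑ i, ∑ j, (w i * (M p i j * v j) +
        v i * (fderiv ℝ (fun z => M z i j) p a * v j + M p i j * w j))) 0 := by
    have : (fun τ : ℝ => energyDensity M ((p, v) + τ • (a, w))) = fun τ : ℝ =>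
        ∑ i, ∑ j, (v + τ • w) i * (M (p + τ • a) i j * (v + τ • w) j) := by
      ext τ
      exact metricForm_eq_sum _ _
    rw [this]
    refine HasDerivAt.fun_sum fun i _ => HasDerivAt.fun_sum fun j _ => ?_
    simpa using (hline i).fun_mul ((hMd i j).fun_mul (hline j))
  rw [h1.unique h2, two_mul]
  nth_rewrite 1 [metricForm_comm hMp]
  rw [metricForm_eq_sum, metricForm_eq_sum]
  simp only [lieDeriv, dotProduct, Matrix.mulVec, Matrix.of_apply, Finset.mul_sum,
    ← Finset.sum_add_distrib]
  refine Finset.sum_congr rfl fun i _ => Finset.sum_congr rfl fun j _ => ?_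
  ring

theorem continuousOn_velocity {c : ℝ → Vec n} (hc : ContDiffOn ℝ 1 c (Icc 0 1)) :
    ContinuousOn (velocity c) (Icc 0 1) :=
  hc.continuousOn_derivWithin (uniqueDiffOn_Icc zero_lt_one) le_rfl

theorem hasDerivWithinAt_velocity {c : ℝ → Vec n} (hc : ContDiffOn ℝ 1 c (Icc 0 1)) {s : ℝ}
    (hs : s ∈ Icc (0 : ℝ) 1) : HasDerivWithinAt c (velocity c s) (Icc 0 1) s :=
  (hc.differentiableOn one_ne_zero s hs).hasDerivWithinAt

theorem velocity_eq {c : ℝ → Vec n} {c' : Vec n} {s : ℝ} (hs : s ∈ Icc (0 : ℝ) 1)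
    (h : HasDerivWithinAt c c' (Icc 0 1) s) : velocity c s = c' :=
  h.derivWithin (uniqueDiffOn_Icc zero_lt_one s hs)

theorem continuousOn_metricForm_velocity (hM : MatrixC1On M X) {c : ℝ → Vec n}
    (hc : ContDiffOn ℝ 1 c (Icc 0 1)) (hcX : ∀ s ∈ Icc (0 : ℝ) 1, c s ∈ X) :
    ContinuousOn (fun s => metricForm M (c s) (velocity c s) (velocity c s)) (Icc 0 1) :=
  (contDiffOn_energyDensity hM).continuousOn.comp
    (hc.continuousOn.prodMk (continuousOn_velocity hc)) fun s hs => ⟨hcX s hs, mem_univ _⟩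

theorem curveLength_nonneg (c : ℝ → Vec n) : 0 ≤ curveLength M c :=
  intervalIntegral.integral_nonneg zero_le_one fun _ _ => Real.sqrt_nonneg _

theorem riemannDist_nonneg (p q : Vec n) : 0 ≤ riemannDist X M p q :=
  Real.sInf_nonneg (by rintro _ ⟨c, _, rfl⟩; exact curveLength_nonneg c)

theorem riemannDist_le_curveLength {p q : Vec n} {c : ℝ → Vec n} (hc : c ∈ curves X p q) :
    riemannDist X M p q ≤ curveLength M c :=
  csInf_le ⟨0, by rintro _ ⟨c, _, rfl⟩; exact curveLength_nonneg c⟩ ⟨c, hc, rfl⟩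

/-- Cauchy–Schwarz on the unit interval: integrate (√φ - m)² ≥ 0, where m is the length, that is,
the mean speed. Unlike the length, the energy integral is C¹ under variations even where the
velocity vanishes. -/
theorem energy_le_integral (hM : MatrixC1On M X) (hMpos : ∀ x ∈ X, (M x).PosDef) {p q : Vec n}
    {c : ℝ → Vec n} (hc : c ∈ curves X p q) :
    energy X M p q ≤ ∫ s in (0 : ℝ)..1, metricForm M (c s) (velocity c s) (velocity c s) := by
  set φ := fun s => metricForm M (c s) (velocity c s) (velocity c s) with hφ
  have hI : uIcc (0 : ℝ) 1 = Icc 0 1 := uIcc_of_le zero_le_one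
  have hφc : ContinuousOn φ (uIcc 0 1) := hI ▸ continuousOn_metricForm_velocity hM hc.1 hc.2.1
  set m := curveLength M c with hm
  have h1 : energy X M p q ≤ m ^ 2 := by
    have := riemannDist_le_curveLength (M := M) hc
    exact pow_le_pow_left₀ (riemannDist_nonneg _ _) this 2
  have h2 : ∫ s in (0 : ℝ)..1, (φ s - 2 * m * √(φ s) + m ^ 2) =
      (∫ s in (0 : ℝ)..1, φ s) - 2 * m * m + m ^ 2 := by
    have hs : ContinuousOn (fun s => √(φ s)) (uIcc 0 1) := hφc.sqrt
    rw [intervalIntegral.integral_add, intervalIntegral.integral_sub,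
      intervalIntegral.integral_const_mul]
    · simp [hm, curveLength, hφ]
    · exact hφc.intervalIntegrable
    · exact (continuousOn_const.mul hs).intervalIntegrable
    · exact (hφc.sub (continuousOn_const.mul hs)).intervalIntegrable
    · simp
  have h3 : 0 ≤ ∫ s in (0 : ℝ)..1, (φ s - 2 * m * √(φ s) + m ^ 2) := by
    refine intervalIntegral.integral_nonneg zero_le_one fun s hs => ?_
    have := Real.sq_sqrt (metricForm_self_nonneg (hMpos _ (hc.2.1 s hs)) (velocity c s))
    change √(φ s) ^ 2 = φ s at this
    nlinarith [sq_nonneg (√(φ s) - m)]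
  nlinarith

theorem IsMinGeodesic.metricForm_eq (hMpos : ∀ x ∈ X, (M x).PosDef) {p q : Vec n} {c : ℝ → Vec n}
    (hc : IsMinGeodesic X M p q c) {s : ℝ} (hs : s ∈ Icc (0 : ℝ) 1) :
    metricForm M (c s) (velocity c s) (velocity c s) = energy X M p q := by
  rw [energy, ← hc.2 s hs, Real.sq_sqrt (metricForm_self_nonneg (hMpos _ (hc.1.2.1 s hs)) _)]

/-- The derivative of the energy integral of the curve `c` in the direction of the field `V`
along `c`. -/
noncomputable def firstVariation (M : Vec n → Matrix (Fin n) (Fin n) ℝ) (c V : ℝ → Vec n) : ℝ :=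
  ∫ s in (0 : ℝ)..1, ((velocity c s).ofLp ⬝ᵥ (lieDeriv M (V s) (c s) *ᵥ (velocity c s).ofLp) +
    2 * metricForm M (c s) (velocity c s) (velocity V s))

end Variation


/-! ### Upper right Dini derivative of the energy -/

section Dini

variable {n : ℕ} {X : Set (Vec n)} {M : Vec n → Matrix (Fin n) (Fin n) ℝ}

/-- The perturbation `τ W(s) + (1 - s) ^ (k + 1) α + s ^ (k + 1) β` of a curve and of its velocity,
as a linear function of `(τ, α, β)`. -/
noncomputable def endpointPerturbation (W : ℝ → Vec n) (k : ℕ) (s : ℝ) :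
    ℝ × Vec n × Vec n →L[ℝ] Vec n × Vec n :=
  ((ContinuousLinearMap.fst ℝ ℝ (Vec n × Vec n)).smulRight (W s)
    + (1 - s) ^ (k + 1) • (ContinuousLinearMap.fst ℝ (Vec n) (Vec n)).comp
        (ContinuousLinearMap.snd ℝ ℝ (Vec n × Vec n))
    + s ^ (k + 1) • (ContinuousLinearMap.snd ℝ (Vec n) (Vec n)).comp
        (ContinuousLinearMap.snd ℝ ℝ (Vec n × Vec n))).prod
  ((ContinuousLinearMap.fst ℝ ℝ (Vec n × Vec n)).smulRight (velocity W s)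
    + (-((k + 1) * (1 - s) ^ k)) • (ContinuousLinearMap.fst ℝ (Vec n) (Vec n)).comp
        (ContinuousLinearMap.snd ℝ ℝ (Vec n × Vec n))
    + ((k + 1) * s ^ k) • (ContinuousLinearMap.snd ℝ (Vec n) (Vec n)).comp
        (ContinuousLinearMap.snd ℝ ℝ (Vec n × Vec n)))

theorem endpointPerturbation_apply (W : ℝ → Vec n) (k : ℕ) (s : ℝ) (θ : ℝ × Vec n × Vec n) :
    endpointPerturbation W k s θ =
      (θ.1 • W s + (1 - s) ^ (k + 1) • θ.2.1 + s ^ (k + 1) • θ.2.2,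
        θ.1 • velocity W s + (-((k + 1) * (1 - s) ^ k)) • θ.2.1 + ((k + 1) * s ^ k) • θ.2.2) :=
  rfl

theorem continuousOn_endpointPerturbation {W : ℝ → Vec n} (hW : ContDiffOn ℝ 1 W (Icc 0 1))
    (k : ℕ) : ContinuousOn (endpointPerturbation W k) (Icc 0 1) := by
  have h1 := hW.continuousOn
  have h2 := continuousOn_velocity hW
  refine continuousOn_clm_apply.2 fun θ => ?_
  simp only [endpointPerturbation_apply]
  fun_prop

theorem hasDerivWithinAt_endpointPerturbation {W : ℝ → Vec n} (hW : ContDiffOn ℝ 1 W (Icc 0 1))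
    (k : ℕ) (θ : ℝ × Vec n × Vec n) {s : ℝ} (hs : s ∈ Icc (0 : ℝ) 1) :
    HasDerivWithinAt (fun s => (endpointPerturbation W k s θ).1) (endpointPerturbation W k s θ).2
      (Icc 0 1) s := by
  simp only [endpointPerturbation_apply]
  have h1 : HasDerivAt (fun s : ℝ => (1 - s) ^ (k + 1)) (-((k + 1) * (1 - s) ^ k)) s := by
    simpa using ((hasDerivAt_id s).const_sub 1).fun_pow (k + 1)
  have h2 : HasDerivAt (fun s : ℝ => s ^ (k + 1)) ((k + 1) * s ^ k) s := by
    simpa using (hasDerivAt_id s).fun_pow (k + 1)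
  exact (((hasDerivWithinAt_velocity hW hs).const_smul θ.1).add
    (h1.smul_const θ.2.1).hasDerivWithinAt).add (h2.smul_const θ.2.2).hasDerivWithinAt

/-- The perturbed curve is a competitor joining the moved end points, so its energy integral bounds
the energy later on. At time t it is the geodesic itself and equality holds, so the right derivative
of the integral controls the growth. -/
theorem energy_eventually_le_of_endpointPerturbation (hX : IsOpen X) (hM : MatrixC1On M X)
    (hMpos : ∀ x ∈ X, (M x).PosDef) {p q : ℝ → Vec n} {t : ℝ} {p' q' : Vec n}
    (hp : HasDerivWithinAt p p' (Ici t) t) (hq : HasDerivWithinAt q q' (Ici t) t)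
    {γ : ℝ → Vec n} (hγ : IsMinGeodesic X M (p t) (q t) γ) {W : ℝ → Vec n}
    (hW : ContDiffOn ℝ 1 W (Icc 0 1)) (k : ℕ) {G : ℝ}
    (hG : ∫ s in (0 : ℝ)..1, fderiv ℝ (energyDensity M) (γ s, velocity γ s)
      (endpointPerturbation W k s (1, p' - W 0, q' - W 1)) < G) :
    ∀ᶠ s in 𝓝[>] t, energy X M (p s) (q s) ≤ energy X M (p t) (q t) + (s - t) * G := by
  obtain ⟨⟨hγc, hγX, hγ0, hγ1⟩, -⟩ := id hγ
  set A := endpointPerturbation W k with hAdef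
  have hA : ContinuousOn A (Icc 0 1) := continuousOn_endpointPerturbation hW k
  have hO : IsOpen (X ×ˢ (univ : Set (Vec n))) := hX.prod isOpen_univ
  have hΓ : ContinuousOn (fun s => (γ s, velocity γ s)) (Icc 0 1) :=
    hγc.continuousOn.prodMk (continuousOn_velocity hγc)
  have hΓO : ∀ s ∈ Icc (0 : ℝ) 1, (γ s, velocity γ s) ∈ X ×ˢ (univ : Set (Vec n)) :=
    fun s hs => ⟨hγX s hs, mem_univ _⟩
  have hG1 := contDiffOn_energyDensity hM
  have hJ := hasFDerivAt_integral_affine hO hG1 hΓ hΓO hA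
  set J := fun θ => ∫ s in (0 : ℝ)..1, energyDensity M ((γ s, velocity γ s) + A s θ) with hJdef
  -- Subtracting (h - t) W at the ends compensates the field W, so that the perturbed curve starts
  -- exactly at p h and ends exactly at q h.
  set θ : ℝ → ℝ × Vec n × Vec n := fun h =>
    (h - t, p h - p t - (h - t) • W 0, q h - q t - (h - t) • W 1) with hθdef
  have hθt : θ t = 0 := by simp [hθdef]
  have hid : HasDerivWithinAt (fun h : ℝ => h - t) 1 (Ici t) t :=
    ((hasDerivAt_id t).sub_const t).hasDerivWithinAt
  have hθ : HasDerivWithinAt θ (1, p' - W 0, q' - W 1) (Ici t) t := by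
    refine hid.prodMk (HasDerivWithinAt.prodMk ?_ ?_)
    · simpa using (hp.sub_const (p t)).fun_sub (hid.smul_const (W 0))
    · simpa using (hq.sub_const (q t)).fun_sub (hid.smul_const (W 1))
  have hJθ := HasFDerivAt.comp_hasDerivWithinAt t (hθt ▸ hJ) hθ
  rw [ContinuousLinearMap.intervalIntegral_apply] at hJθ
  swap
  · refine ContinuousOn.intervalIntegrable ?_
    rw [uIcc_of_le zero_le_one]
    exact ((hG1.continuousOn_fderiv_of_isOpen hO le_rfl).comp hΓ hΓO).clm_comp hA
  have hslope := (hasDerivWithinAt_iff_tendsto_slope' (by simp)).1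
    (hJθ.mono Ioi_subset_Ici_self) |>.eventually_lt_const hG
  have hmem : ∀ᶠ h in 𝓝[>] t, ∀ s ∈ Icc (0 : ℝ) 1,
      (γ s, velocity γ s) + A s (θ h) ∈ X ×ˢ (univ : Set (Vec n)) := by
    have h1 : Tendsto θ (𝓝[>] t) (𝓝 0) := by
      have := hθ.continuousWithinAt.tendsto
      rw [hθt] at this
      exact this.mono_left (nhdsWithin_mono _ Ioi_subset_Ici_self)
    exact h1.eventually (eventually_forall_mem_of_isOpen hO hΓ hΓO hA)
  have hJ0 : J (θ t) = energy X M (p t) (q t) := by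
    simp only [hJdef, hθt, map_zero, add_zero]
    rw [intervalIntegral.integral_congr (g := fun _ => energy X M (p t) (q t))]
    · simp
    · intro s hs
      rw [uIcc_of_le zero_le_one] at hs
      exact hγ.metricForm_eq hMpos hs
  filter_upwards [hslope, hmem, self_mem_nhdsWithin] with h h1 h2 h3
  have hht : 0 < h - t := sub_pos.2 h3
  rw [slope_def_field, div_lt_iff₀ hht, Function.comp, Function.comp, hJ0] at h1
  set c : ℝ → Vec n := fun s => γ s + (A s (θ h)).1 with hc
  have hcd : ∀ s ∈ Icc (0 : ℝ) 1, HasDerivWithinAt c (velocity γ s + (A s (θ h)).2) (Icc 0 1) s :=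
    fun s hs => (hasDerivWithinAt_velocity hγc hs).add
      (hasDerivWithinAt_endpointPerturbation hW k (θ h) hs)
  have hcv : ∀ s ∈ Icc (0 : ℝ) 1, velocity c s = velocity γ s + (A s (θ h)).2 :=
    fun s hs => velocity_eq hs (hcd s hs)
  have hcC : ContDiffOn ℝ 1 c (Icc 0 1) := by
    refine hγc.add ?_
    simp only [hAdef, endpointPerturbation_apply]
    fun_prop
  have hcurve : c ∈ curves X (p h) (q h) := by
    refine ⟨hcC, fun s hs => (h2 s hs).1, ?_, ?_⟩
    · simp [hc, hAdef, endpointPerturbation_apply, hγ0, hθdef]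
    · simp [hc, hAdef, endpointPerturbation_apply, hγ1, hθdef]
  have hle := energy_le_integral hM hMpos hcurve
  have heq : ∫ s in (0 : ℝ)..1, metricForm M (c s) (velocity c s) (velocity c s) = J (θ h) := by
    refine intervalIntegral.integral_congr fun s hs => ?_
    rw [uIcc_of_le zero_le_one] at hs
    simp only [hcv s hs]
    rfl
  rw [heq] at hle
  linarith

/-- The upper right Dini derivative of the energy between two moving points is bounded by any first
variation with compatible end point velocities. -/
theorem energy_eventually_le (hX : IsOpen X) (hM : MatrixC1On M X)
    (hMpos : ∀ x ∈ X, (M x).PosDef) {p q : ℝ → Vec n} {t : ℝ} {p' q' : Vec n}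
    (hp : HasDerivWithinAt p p' (Ici t) t) (hq : HasDerivWithinAt q q' (Ici t) t)
    {γ : ℝ → Vec n} (hγ : IsMinGeodesic X M (p t) (q t) γ) {W : ℝ → Vec n}
    (hW : ContDiffOn ℝ 1 W (Icc 0 1)) {G : ℝ}
    (hG : firstVariation M γ W + 2 * metricForm M (q t) (velocity γ 1) (q' - W 1)
      - 2 * metricForm M (p t) (velocity γ 0) (p' - W 0) < G) :
    ∀ᶠ s in 𝓝[>] t, energy X M (p s) (q s) ≤ energy X M (p t) (q t) + (s - t) * G := by
  obtain ⟨⟨hγc, hγX, hγ0, hγ1⟩, -⟩ := id hγ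
  set α := p' - W 0
  set β := q' - W 1
  have hO : IsOpen (X ×ˢ (univ : Set (Vec n))) := hX.prod isOpen_univ
  obtain ⟨D, hDdef⟩ : ∃ D : ℝ → (Vec n × Vec n →L[ℝ] ℝ),
    D = fun s => fderiv ℝ (energyDensity M) (γ s, velocity γ s) := ⟨_, rfl⟩
  have hD : ContinuousOn D (Icc 0 1) :=
    hDdef ▸ ((contDiffOn_energyDensity hM).continuousOn_fderiv_of_isOpen hO le_rfl).comp
      (hγc.continuousOn.prodMk (continuousOn_velocity hγc)) fun s hs => ⟨hγX s hs, mem_univ _⟩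
  have hDa : ∀ y, ContinuousOn (fun s => D s y) (Icc 0 1) := fun y =>
    hD.clm_apply continuousOn_const
  obtain ⟨w, hw⟩ : ∃ w : ℝ → ℝ, w = fun s => D s (W s, velocity W s) := ⟨_, rfl⟩
  have hDW : ContinuousOn w (Icc 0 1) :=
    hw ▸ hD.clm_apply (hW.continuousOn.prodMk (continuousOn_velocity hW))
  have hint : ∀ {φ : ℝ → ℝ}, ContinuousOn φ (Icc 0 1) → IntervalIntegrable φ volume 0 1 :=
    fun h => ContinuousOn.intervalIntegrable (by rwa [uIcc_of_le zero_le_one])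
  have hev : ∀ s ∈ Icc (0 : ℝ) 1, ∀ a w, D s (a, w) =
      (velocity γ s).ofLp ⬝ᵥ (lieDeriv M a (γ s) *ᵥ (velocity γ s).ofLp) +
        2 * metricForm M (γ s) (velocity γ s) w := fun s hs a w => hDdef ▸
    fderiv_energyDensity hX hM (hγX s hs) (hMpos _ (hγX s hs)) _ _ _
  have hev0 : ∀ s ∈ Icc (0 : ℝ) 1, ∀ w, D s (0, w) =
      2 * metricForm M (γ s) (velocity γ s) w := fun s hs w => by
    rw [hev s hs]
    have : lieDeriv M 0 (γ s) = 0 := by ext i j; simp [lieDeriv]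
    simp [this]
  have hfv : ∫ s in (0 : ℝ)..1, w s = firstVariation M γ W :=
    hw ▸ intervalIntegral.integral_congr fun s hs => by
      rw [uIcc_of_le zero_le_one] at hs
      exact hev s hs _ _
  -- Linearity of the derivative splits off the end point corrections. Their position parts carry
  -- powers without a factor k + 1 and vanish as k → ∞; their velocity parts carry the densities (k
  -- + 1) sᵏ or (k + 1) (1 - s)ᵏ and concentrate at the ends.
  have hk : ∀ k : ℕ, ∫ s in (0 : ℝ)..1, D s (endpointPerturbation W k s (1, α, β)) =
      firstVariation M γ W
        + (∫ s in (0 : ℝ)..1, (1 - s) ^ k * ((1 - s) * D s (α, 0)))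
        - (k + 1) * (∫ s in (0 : ℝ)..1, (1 - s) ^ k * D s (0, α))
        + (∫ s in (0 : ℝ)..1, s ^ k * (s * D s (β, 0)))
        + (k + 1) * ∫ s in (0 : ℝ)..1, s ^ k * D s (0, β) := by
    intro k
    have h1 := hDa (α, 0)
    have h2 := hDa (0, α)
    have h3 := hDa (β, 0)
    have h4 := hDa (0, β)
    rw [← hfv, ← intervalIntegral.integral_const_mul, ← intervalIntegral.integral_const_mul,
      ← intervalIntegral.integral_add (hint hDW) (hint (by fun_prop)),
      ← intervalIntegral.integral_sub (hint (by fun_prop)) (hint (by fun_prop)),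
      ← intervalIntegral.integral_add (hint (by fun_prop)) (hint (by fun_prop)),
      ← intervalIntegral.integral_add (hint (by fun_prop)) (hint (by fun_prop))]
    congr 1
    ext s
    have : endpointPerturbation W k s (1, α, β) = (W s, velocity W s)
        + ((1 - s) ^ k * (1 - s)) • (α, (0 : Vec n)) - ((k + 1) * (1 - s) ^ k) • ((0 : Vec n), α)
        + (s ^ k * s) • (β, (0 : Vec n)) + ((k + 1) * s ^ k) • ((0 : Vec n), β) := by
      rw [endpointPerturbation_apply]
      ext1
      · simp [pow_succ]
      · simp [sub_eq_add_neg]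
    rw [this, hw]
    simp only [map_add, map_sub, map_smul, smul_eq_mul]
    ring
  have hlim : Tendsto (fun k : ℕ => ∫ s in (0 : ℝ)..1, D s (endpointPerturbation W k s (1, α, β)))
      atTop (𝓝 (firstVariation M γ W + 0 - D 0 (0, α) + 0 + D 1 (0, β))) := by
    simp only [hk]
    have h1 := hDa (α, 0)
    have h3 := hDa (β, 0)
    exact (((tendsto_const_nhds.add
      (tendsto_zero_of_tendsto_succ_mul (tendsto_integral_pow_mul_zero (by fun_prop)))).sub
      (tendsto_integral_pow_mul_zero (hDa (0, α)))).add
      (tendsto_zero_of_tendsto_succ_mul (tendsto_integral_pow_mul_one (by fun_prop)))).add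
      (tendsto_integral_pow_mul_one (hDa (0, β)))
  obtain ⟨k, hk⟩ := (hlim.eventually_lt_const (u := G) (by
    rw [hev0 0 (by simp), hev0 1 (by simp), hγ0, hγ1]; linarith)).exists
  exact energy_eventually_le_of_endpointPerturbation hX hM hMpos hp hq hγ hW k
    (by simpa only [hDdef] using hk)

end Dini


/-! ### Lower semicontinuity of the distance along geodesics in a set where `M` is bounded -/

section Semicontinuity

variable {n : ℕ} {X S : Set (Vec n)} {M : Vec n → Matrix (Fin n) (Fin n) ℝ}

/-- Allows the ends of a curve to be moved while its middle part is left untouched. -/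
theorem exists_cutoff {κ : ℝ} (hκ : 0 < κ) : ∃ ψ : ℝ → ℝ, ContDiff ℝ 1 ψ ∧ ψ 1 = 1 ∧
    (∀ s, 0 ≤ ψ s ∧ ψ s ≤ 1) ∧ (∀ s ≤ 1 - κ, ψ s = 0) ∧ (∀ s < 1 - κ, deriv ψ s = 0) := by
  have h0 : ∀ s ≤ 1 - κ, Real.smoothTransition ((s - (1 - κ)) / κ) = 0 := fun s hs =>
    Real.smoothTransition.zero_of_nonpos (div_nonpos_of_nonpos_of_nonneg (by linarith) hκ.le)
  refine ⟨fun s => Real.smoothTransition ((s - (1 - κ)) / κ),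
    Real.smoothTransition.contDiff.comp (by fun_prop), ?_,
    fun s => ⟨Real.smoothTransition.nonneg _, Real.smoothTransition.le_one _⟩, h0, fun s hs => ?_⟩
  · have : (1 - (1 - κ)) / κ = 1 := by field_simp; ring
    simp only [this, Real.smoothTransition.one]
  · have : (fun s => Real.smoothTransition ((s - (1 - κ)) / κ)) =ᶠ[𝓝 s] fun _ => 0 := by
      filter_upwards [Iio_mem_nhds hs] with r hr using h0 r (le_of_lt hr)
    rw [this.deriv_eq, deriv_const]

theorem IsMinGeodesic.norm_velocity_le (hMS : ∀ x ∈ S, (M x).PosDef) (hlo : 0 < infMinEig M S)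
    {p q : Vec n} {γ : ℝ → Vec n} (hγ : IsMinGeodesic X M p q γ)
    (hγS : ∀ s ∈ Icc (0 : ℝ) 1, γ s ∈ S) {s : ℝ} (hs : s ∈ Icc (0 : ℝ) 1) :
    ‖velocity γ s‖ ≤ riemannDist X M p q / √(infMinEig M S) := by
  rw [← hγ.2 s hs]
  exact norm_le_of_sqrt_metricForm hMS hlo (hγS s hs) _

theorem IsMinGeodesic.norm_sub_le (hMS : ∀ x ∈ S, (M x).PosDef) (hlo : 0 < infMinEig M S)
    {p q : Vec n} {γ : ℝ → Vec n} (hγ : IsMinGeodesic X M p q γ)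
    (hγS : ∀ s ∈ Icc (0 : ℝ) 1, γ s ∈ S) {s r : ℝ} (hs : s ∈ Icc (0 : ℝ) 1)
    (hr : r ∈ Icc (0 : ℝ) 1) :
    ‖γ s - γ r‖ ≤ riemannDist X M p q / √(infMinEig M S) * |s - r| :=
  (convex_Icc (0 : ℝ) 1).norm_image_sub_le_of_norm_hasDerivWithin_le
    (fun _ hx => hasDerivWithinAt_velocity hγ.1.1 hx)
    (fun _ hx => hγ.norm_velocity_le hMS hlo hγS hx) hr hs

/-- A geodesic between nearby points is bent, only on parameter intervals of length κ at its ends,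
into a curve from p to q. The middle costs at most the old distance. The end pieces have bounded
speed, hence length of order κ. -/
theorem exists_riemannDist_le_add (hS : IsOpen S) (hSX : S ⊆ X) (hM : MatrixC1On M X)
    (hMS : ∀ x ∈ S, (M x).PosDef)
    (hhi : BddAbove ((fun x => maxEig (M x)) '' S)) (hlo : 0 < infMinEig M S)
    {p q : Vec n} (hp : p ∈ S) (hq : q ∈ S) {ε : ℝ} (hε : 0 < ε) :
    ∃ ρ > 0, ∀ p' q' γ, ‖p - p'‖ < ρ → ‖q - q'‖ < ρ → IsMinGeodesic X M p' q' γ →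
      (∀ s ∈ Icc (0 : ℝ) 1, γ s ∈ S) → riemannDist X M p q ≤ riemannDist X M p' q' + ε := by
  set K := riemannDist X M p q / √(infMinEig M S) with hK
  have hK0 : 0 ≤ K := div_nonneg (riemannDist_nonneg _ _) (Real.sqrt_nonneg _)
  set C := √(supMaxEig M S) with hC
  have hC0 : 0 ≤ C := Real.sqrt_nonneg _
  obtain ⟨R₁, hR₁, hpR⟩ := Metric.isOpen_iff.1 hS p hp
  obtain ⟨R₂, hR₂, hqR⟩ := Metric.isOpen_iff.1 hS q hq
  -- The bounds on K κ keep the bent end pieces inside balls contained in S; the last one bounds the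
  -- total length of both pieces.
  obtain ⟨κ, hκ, hκ1, hκ2, hκ3, hκ4⟩ : ∃ κ > 0, κ < 1 / 2 ∧ K * κ < R₁ / 2 ∧ K * κ < R₂ / 2 ∧
      2 * κ * (C * (K + 1)) < ε := by
    have h : ∀ᶠ κ in 𝓝[>] (0 : ℝ), κ < 1 / 2 ∧ K * κ < R₁ / 2 ∧ K * κ < R₂ / 2 ∧
      2 * κ * (C * (K + 1)) < ε := by
      refine Filter.Eventually.filter_mono nhdsWithin_le_nhds ?_
      have c1 : ContinuousAt (fun κ : ℝ => K * κ) 0 := by fun_prop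
      have c2 : ContinuousAt (fun κ : ℝ => 2 * κ * (C * (K + 1))) 0 := by fun_prop
      exact (eventually_lt_nhds (by norm_num)).and ((c1.eventually_lt_const (by simpa using hR₁)).and
        ((c1.eventually_lt_const (by simpa using hR₂)).and
          (c2.eventually_lt_const (by simpa using hε))))
    obtain ⟨κ, hκ, h⟩ := (eventually_mem_nhdsWithin.and h).exists
    exact ⟨κ, hκ, h⟩
  obtain ⟨ψ, hψ, hψ1, hψI, hψ0, hψd⟩ := exists_cutoff hκ
  obtain ⟨Cψ, hCψ⟩ := isCompact_Icc.exists_bound_of_continuousOn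
    (s := Icc (0 : ℝ) 1) (hψ.continuous_deriv le_rfl).continuousOn
  have hCψ0 : 0 ≤ Cψ := (norm_nonneg _).trans (hCψ 0 (by simp))
  -- The radius 1 / (2 (Cψ + 1)) lets each cutoff change the velocity by at most 1/2, so the bent
  -- curve has Euclidean speed at most K + 1.
  refine ⟨min (min (R₁ / 2) (R₂ / 2)) (1 / (2 * (Cψ + 1))), by positivity,
    fun p' q' γ hp' hq' hγ hγS => ?_⟩
  simp only [lt_min_iff] at hp' hq'
  -- The negation gives dist(p', q') < dist(p, q), so K bounds the speed of γ independently of p'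
  -- and q'.
  by_contra! hcon
  set δ := riemannDist X M p' q' with hδ
  have hδK : δ / √(infMinEig M S) ≤ K := by
    rw [hK]; gcongr; linarith
  have hγd : ∀ s ∈ Icc (0 : ℝ) 1, ‖velocity γ s‖ ≤ K := fun s hs =>
    (hγ.norm_velocity_le hMS hlo hγS hs).trans hδK
  have hγL : ∀ s ∈ Icc (0 : ℝ) 1, ∀ r ∈ Icc (0 : ℝ) 1, ‖γ s - γ r‖ ≤ K * |s - r| :=
    fun s hs r hr => (hγ.norm_sub_le hMS hlo hγS hs hr).trans (by gcongr)
  obtain ⟨⟨hγc, hγX, hγ0, hγ1⟩, hγs⟩ := id hγ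
  set c : ℝ → Vec n := fun s => γ s + ψ s • (q - q') + ψ (1 - s) • (p - p') with hc
  have hψ1s : ContDiff ℝ 1 fun s => ψ (1 - s) := hψ.comp (by fun_prop)
  have hcC : ContDiffOn ℝ 1 c (Icc 0 1) :=
    (hγc.add (hψ.smul contDiff_const).contDiffOn).add (hψ1s.smul contDiff_const).contDiffOn
  have hcv : ∀ s ∈ Icc (0 : ℝ) 1, velocity c s =
      velocity γ s + deriv ψ s • (q - q') + (-deriv ψ (1 - s)) • (p - p') := by
    intro s hs
    refine velocity_eq hs ?_
    have hd : ∀ s, HasDerivAt ψ (deriv ψ s) s := fun s =>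
      (hψ.differentiable one_ne_zero s).hasDerivAt
    have hd' : HasDerivAt (fun s => ψ (1 - s)) (-deriv ψ (1 - s)) s := by
      refine ((hd (1 - s)).comp s ((hasDerivAt_id s).const_sub 1)).congr_deriv ?_
      ring
    exact ((hasDerivWithinAt_velocity hγc hs).add
      ((hd s).smul_const _).hasDerivWithinAt).add (hd'.smul_const _).hasDerivWithinAt
  have hcS : ∀ s ∈ Icc (0 : ℝ) 1, c s ∈ S := by
    intro s hs
    rcases le_or_gt s (1 - κ) with h1 | h1
    · rcases le_or_gt (1 - s) (1 - κ) with h2 | h2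
      · simp only [hc, hψ0 s h1, hψ0 _ h2, zero_smul, add_zero]
        exact hγS s hs
      · refine hpR (mem_ball_iff_norm.2 ?_)
        have e : c s - p = (γ s - γ 0) + (ψ (1 - s) - 1) • (p - p') := by
          simp only [hc, hψ0 s h1, hγ0, zero_smul, sub_smul, one_smul]; abel
        rw [e]
        refine (norm_add_le _ _).trans_lt ?_
        have n1 := hγL s hs 0 (by simp)
        rw [sub_zero, abs_of_nonneg hs.1] at n1
        have n2 : ‖(ψ (1 - s) - 1) • (p - p')‖ ≤ ‖p - p'‖ := by
          rw [norm_smul]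
          refine mul_le_of_le_one_left (norm_nonneg _) ?_
          rw [Real.norm_eq_abs, abs_le]
          constructor <;> linarith [(hψI (1 - s)).1, (hψI (1 - s)).2]
        have : K * s ≤ K * κ := by gcongr; linarith
        linarith [hp'.1.1]
    · refine hqR (mem_ball_iff_norm.2 ?_)
      have h2 : 1 - s ≤ 1 - κ := by linarith
      have e : c s - q = (γ s - γ 1) + (ψ s - 1) • (q - q') := by
        simp only [hc, hψ0 _ h2, hγ1, zero_smul, sub_smul, one_smul]; abel
      rw [e]
      refine (norm_add_le _ _).trans_lt ?_
      have n1 := hγL s hs 1 (by simp)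
      rw [abs_sub_comm, abs_of_nonneg (by linarith [hs.2])] at n1
      have n2 : ‖(ψ s - 1) • (q - q')‖ ≤ ‖q - q'‖ := by
        rw [norm_smul]
        refine mul_le_of_le_one_left (norm_nonneg _) ?_
        rw [Real.norm_eq_abs, abs_le]
        constructor <;> linarith [(hψI s).1, (hψI s).2]
      have : K * (1 - s) ≤ K * κ := by gcongr; linarith
      linarith [hq'.1.2]
  have hcurve : c ∈ curves X p q := by
    refine ⟨hcC, fun s hs => hSX (hcS s hs), ?_, ?_⟩
    · simp [hc, hψ0 0 (by linarith), hψ1, hγ0]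
    · simp [hc, hψ0 0 (by linarith), hψ1, hγ1]
  set φ := fun s => √(metricForm M (c s) (velocity c s) (velocity c s)) with hφ
  have hφc : ContinuousOn φ (Icc 0 1) :=
    (continuousOn_metricForm_velocity hM hcC hcurve.2.1).sqrt
  have hφH : ∀ s ∈ Icc (0 : ℝ) 1, φ s ≤ C * (K + 1) := by
    intro s hs
    refine (sqrt_metricForm_le hMS hhi (hcS s hs) _).trans ?_
    gcongr
    rw [hcv s hs]
    have hs' : 1 - s ∈ Icc (0 : ℝ) 1 := ⟨by linarith [hs.2], by linarith [hs.1]⟩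
    have hsmall : ∀ v : Vec n, ‖v‖ < 1 / (2 * (Cψ + 1)) → ∀ x : ℝ, ‖x‖ ≤ Cψ →
        ‖x • v‖ ≤ 1 / 2 := by
      intro v hv x hx
      rw [norm_smul]
      calc ‖x‖ * ‖v‖ ≤ (Cψ + 1) * (1 / (2 * (Cψ + 1))) := by gcongr; linarith
        _ = 1 / 2 := by field_simp
    have n1 := hsmall _ hq'.2 _ (hCψ s hs)
    have n2 := hsmall _ hp'.2 (-deriv ψ (1 - s)) (by rw [norm_neg]; exact hCψ _ hs')
    refine (norm_add₃_le).trans ?_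
    linarith [hγd s hs]
  have hmid : ∀ s ∈ Ioo κ (1 - κ), φ s = δ := by
    intro s hs
    have hsI : s ∈ Icc (0 : ℝ) 1 := ⟨by linarith [hs.1], by linarith [hs.2]⟩
    have e1 : velocity c s = velocity γ s := by
      rw [hcv s hsI, hψd s hs.2, hψd (1 - s) (by linarith [hs.1])]; simp
    have e2 : c s = γ s := by
      simp only [hc, hψ0 s hs.2.le, hψ0 (1 - s) (by linarith [hs.1]), zero_smul, add_zero]
    simp only [hφ, e1, e2]
    exact hγs s hsI
  have hsubI : ∀ a b, 0 ≤ a → a ≤ b → b ≤ 1 → IntervalIntegrable φ volume a b :=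
    fun a b ha hab hb => (hφc.mono (by
      rw [uIcc_of_le hab]; exact Icc_subset_Icc ha hb)).intervalIntegrable
  have hκ' : κ ≤ 1 - κ := by linarith
  have hlen : curveLength M c = (∫ s in (0 : ℝ)..κ, φ s) + (∫ s in κ..(1 - κ), φ s)
      + ∫ s in (1 - κ)..1, φ s := by
    rw [intervalIntegral.integral_add_adjacent_intervals,
      intervalIntegral.integral_add_adjacent_intervals]
    · rfl
    all_goals apply hsubI <;> linarith
  have i1 : ∫ s in (0 : ℝ)..κ, φ s ≤ κ * (C * (K + 1)) := by
    have := intervalIntegral.integral_mono_on hκ.le (hsubI 0 κ le_rfl hκ.le (by linarith))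
      (intervalIntegrable_const (c := C * (K + 1))) fun s hs => hφH s ⟨hs.1, by linarith [hs.2]⟩
    rwa [intervalIntegral.integral_const, smul_eq_mul, sub_zero] at this
  have i3 : ∫ s in (1 - κ)..1, φ s ≤ κ * (C * (K + 1)) := by
    have := intervalIntegral.integral_mono_on (by linarith : 1 - κ ≤ 1)
      (hsubI (1 - κ) 1 (by linarith) (by linarith) le_rfl)
      (intervalIntegrable_const (c := C * (K + 1))) fun s hs => hφH s ⟨by linarith [hs.1], hs.2⟩
    rwa [intervalIntegral.integral_const, smul_eq_mul, sub_sub_cancel] at this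
  have i2 : ∫ s in κ..(1 - κ), φ s ≤ δ := by
    have := intervalIntegral.integral_mono_on_of_le_Ioo hκ'
      (hsubI κ (1 - κ) hκ.le hκ' (by linarith))
      (intervalIntegrable_const (c := δ)) fun s hs => (hmid s hs).le
    rw [intervalIntegral.integral_const, smul_eq_mul] at this
    have hδ0 : 0 ≤ δ := riemannDist_nonneg _ _
    nlinarith
  have := riemannDist_le_curveLength (M := M) hcurve
  linarith

theorem energy_eventually_le_add (hS : IsOpen S) (hSX : S ⊆ X) (hM : MatrixC1On M X)
    (hMS : ∀ x ∈ S, (M x).PosDef)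
    (hhi : BddAbove ((fun x => maxEig (M x)) '' S)) (hlo : 0 < infMinEig M S)
    {p q : ℝ → Vec n} {γ : ℝ → ℝ → Vec n} {t₁ t₂ : ℝ} (hp : ContinuousOn p (Icc t₁ t₂))
    (hq : ContinuousOn q (Icc t₁ t₂)) (hγ : ∀ t ∈ Icc t₁ t₂, IsMinGeodesic X M (p t) (q t) (γ t))
    (hγS : ∀ t ∈ Icc t₁ t₂, ∀ s ∈ Icc (0 : ℝ) 1, γ t s ∈ S) {t : ℝ} (ht : t ∈ Ioc t₁ t₂) {ε : ℝ}
    (hε : 0 < ε) :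
    ∀ᶠ s in 𝓝[<] t, energy X M (p t) (q t) ≤ energy X M (p s) (q s) + ε := by
  have htI : t ∈ Icc t₁ t₂ := ⟨ht.1.le, ht.2⟩
  have hpS : p t ∈ S := by
    have := hγS t htI 0 (by simp)
    rwa [(hγ t htI).1.2.2.1] at this
  have hqS : q t ∈ S := by
    have := hγS t htI 1 (by simp)
    rwa [(hγ t htI).1.2.2.2] at this
  set δ := riemannDist X M (p t) (q t) with hδ
  have hδ0 : 0 ≤ δ := riemannDist_nonneg _ _
  -- If δ' ≤ δ then δ² - δ'² ≤ 2 δ (δ - δ'); hence the factor 2 δ, and the extra 1 keeps the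
  -- denominator positive.
  obtain ⟨ρ, hρ, h⟩ := exists_riemannDist_le_add hS hSX hM hMS hhi hlo hpS hqS
    (ε := ε / (2 * δ + 1)) (by positivity)
  have hle : 𝓝[<] t ≤ 𝓝[Icc t₁ t₂] t := by
    rw [← nhdsWithin_Ico_eq_nhdsLT ht.1]
    exact nhdsWithin_mono _ fun s hs => ⟨hs.1, hs.2.le.trans ht.2⟩
  have hnear : ∀ {f : ℝ → Vec n}, ContinuousOn f (Icc t₁ t₂) → ∀ᶠ s in 𝓝[<] t, ‖f t - f s‖ < ρ := by
    intro f hf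
    filter_upwards [((hf t htI).tendsto.mono_left hle).eventually (Metric.ball_mem_nhds _ hρ)]
      with s hs
    rwa [dist_eq_norm, norm_sub_rev] at hs
  filter_upwards [hnear hp, hnear hq, Ico_mem_nhdsLT ht.1] with s h1 h2 h3
  have hsI : s ∈ Icc t₁ t₂ := ⟨h3.1, h3.2.le.trans ht.2⟩
  have h4 := h (p s) (q s) (γ s) h1 h2 (hγ s hsI) (hγS s hsI)
  unfold energy
  have hs0 : 0 ≤ riemannDist X M (p s) (q s) := riemannDist_nonneg _ _
  rw [← hδ] at h4 ⊢
  set δ' := riemannDist X M (p s) (q s)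
  rcases le_total δ δ' with h5 | h5
  · nlinarith
  · have h6 : (2 * δ + 1) * (δ - δ') ≤ ε := by
      rw [← le_div_iff₀' (by positivity)]; linarith
    nlinarith

end Semicontinuity


/-! ### Closed loops satisfying the weak contraction condition -/

section ClosedLoop

variable {n m p : ℕ}

theorem hasDerivWithinAt_of_coord {c : ℝ → Vec n} {c' : Vec n} {T : Set ℝ} {s : ℝ}
    (h : ∀ i, HasDerivWithinAt (fun s => c s i) (c' i) T s) : HasDerivWithinAt c c' T s := by
  rw [hasDerivWithinAt_iff_hasFDerivWithinAt, hasFDerivWithinAt_euclidean]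
  intro i
  refine (h i).hasFDerivWithinAt.congr_fderiv ?_
  ext
  simp

theorem jacobian_mulVec (F : Vec n → Vec p) (x v : Vec n) (i : Fin p) :
    (jacobian F x *ᵥ v.ofLp) i = fderiv ℝ (fun z => F z i) x v := by
  have hv : v = ∑ j, v j • EuclideanSpace.single j (1 : ℝ) := by
    ext j
    simp [Finset.sum_apply, Pi.single_apply]
  conv_rhs => rw [hv]
  simp only [map_sum, map_smul, smul_eq_mul, Matrix.mulVec, dotProduct, jacobian,
    Matrix.of_apply]
  exact Finset.sum_congr rfl fun j _ => mul_comm _ _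

theorem dotProduct_symHat_mulVec (Q : Matrix (Fin n) (Fin n) ℝ) (v : Fin n → ℝ) :
    v ⬝ᵥ (symHat Q *ᵥ v) = 2 * (v ⬝ᵥ (Q *ᵥ v)) := by
  rw [symHat, Matrix.add_mulVec, dotProduct_add, Matrix.mulVec_transpose, dotProduct_comm v (v ᵥ* Q),
    ← Matrix.dotProduct_mulVec, two_mul]

variable {X S : Set (Vec n)} {M : Vec n → Matrix (Fin n) (Fin n) ℝ} {f : Vec n → Vec n}
  {B : Vec n → Matrix (Fin n) (Fin m) ℝ} {κ : Vec n → Vec m} {γ : ℝ → Vec n}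

theorem contDiffOn_affine_comp (hf : ContDiffOn ℝ 1 f X) (hB : MatrixC1On B X) (hSX : S ⊆ X)
    (hκ : ContDiffOn ℝ 1 κ S) (hγ : ContDiffOn ℝ 1 γ (Icc 0 1))
    (hγS : ∀ s ∈ Icc (0 : ℝ) 1, γ s ∈ S) :
    ContDiffOn ℝ 1 (fun s => affine f B (γ s) (κ (γ s))) (Icc 0 1) := by
  have hγX : MapsTo γ (Icc 0 1) X := fun s hs => hSX (hγS s hs)
  refine contDiffOn_euclidean.2 fun i => ?_
  simp only [affine, PiLp.add_apply, Matrix.mulVec, dotProduct]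
  exact (contDiffOn_euclidean.1 (hf.comp hγ hγX) i).add (ContDiffOn.sum fun j _ =>
    ((hB i j).comp hγ hγX).mul (contDiffOn_euclidean.1 (hκ.comp hγ hγS) j))

/-- The Jacobian `A + B K` of the closed-loop vector field `f + B κ`. -/
noncomputable def closedLoopJacobian (f : Vec n → Vec n) (B : Vec n → Matrix (Fin n) (Fin m) ℝ)
    (κ : Vec n → Vec m) (x : Vec n) : Matrix (Fin n) (Fin n) ℝ :=
  (jacobian f x + ∑ j, κ x j • jacobian (column B j) x) + B x * jacobian κ x

/-- Chain and product rule: differentiating B gives the sum over its columns in A, and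
differentiating κ gives B K. -/
theorem velocity_affine_comp (hX : IsOpen X) (hS : IsOpen S) (hf : ContDiffOn ℝ 1 f X)
    (hB : MatrixC1On B X) (hSX : S ⊆ X) (hκ : ContDiffOn ℝ 1 κ S)
    (hγ : ContDiffOn ℝ 1 γ (Icc 0 1)) {s : ℝ} (hs : s ∈ Icc (0 : ℝ) 1) (hγS : γ s ∈ S) :
    velocity (fun s => affine f B (γ s) (κ (γ s))) s =
      WithLp.toLp 2 (closedLoopJacobian f B κ (γ s) *ᵥ (velocity γ s).ofLp) := by
  refine velocity_eq hs (hasDerivWithinAt_of_coord fun i => ?_)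
  set v := velocity γ s
  have hv : HasDerivWithinAt γ v (Icc 0 1) s := hasDerivWithinAt_velocity hγ hs
  have hcomp : ∀ {φ : Vec n → ℝ} {T : Set (Vec n)}, IsOpen T → γ s ∈ T → ContDiffOn ℝ 1 φ T →
      HasDerivWithinAt (fun s => φ (γ s)) (fderiv ℝ φ (γ s) v) (Icc 0 1) s := by
    intro φ T hT hsT hφ
    exact ((hφ.differentiableOn one_ne_zero).differentiableAt
      (hT.mem_nhds hsT)).hasFDerivAt.comp_hasDerivWithinAt s hv
  have h1 := hcomp hX (hSX hγS) (contDiffOn_euclidean.1 hf i)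
  have h2 : ∀ j, _ := fun j => hcomp hX (hSX hγS) (hB i j)
  have h3 : ∀ j, _ := fun j => hcomp hS hγS (contDiffOn_euclidean.1 hκ j)
  simp only [affine, PiLp.add_apply, Matrix.mulVec, dotProduct]
  refine (h1.add (HasDerivWithinAt.fun_sum fun j _ => (h2 j).fun_mul (h3 j))).congr_deriv ?_
  change _ = (closedLoopJacobian f B κ (γ s) *ᵥ v.ofLp) i
  simp only [closedLoopJacobian, Matrix.add_mulVec, Matrix.sum_mulVec, Matrix.smul_mulVec,
    ← Matrix.mulVec_mulVec, Pi.add_apply, Finset.sum_apply, Pi.smul_apply, jacobian_mulVec,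
    smul_eq_mul]
  rw [Finset.sum_add_distrib, add_assoc]
  congr 2
  · exact Finset.sum_congr rfl fun j _ => mul_comm _ _
  · simp only [Matrix.mulVec, dotProduct]
    refine Finset.sum_congr rfl fun j _ => ?_
    congr 1
    exact (jacobian_mulVec κ (γ s) v j).symm

/-- With the nominal pair frozen, the integrand plus 2 lam vᵀ M v is the contraction matrix
evaluated at the geodesic velocity v, hence nonpositive. Constant speed makes vᵀ M v equal to the
energy. -/
theorem WeakCCM.firstVariation_le {D : Set (StateControl n m)} {lam : ℝ}
    {k : Vec n → Vec n → Vec m → Vec m} (hk : WeakCCM f B M lam k D) (hX : IsOpen X)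
    (hS : IsOpen (projState D)) (hSX : projState D ⊆ X) (hf : ContDiffOn ℝ 1 f X)
    (hB : MatrixC1On B X) (hM : MatrixC1On M X) (hMpos : ∀ x ∈ X, (M x).PosDef)
    {x₀ : Vec n} {u₀ : Vec m} (h₀ : pair x₀ u₀ ∈ D) {p q : Vec n}
    (hγ : IsMinGeodesic X M p q γ) (hγS : ∀ s ∈ Icc (0 : ℝ) 1, γ s ∈ projState D) :
    firstVariation M γ (fun s => affine f B (γ s) (k (γ s - x₀) x₀ u₀)) ≤
      -2 * lam * energy X M p q := by
  obtain ⟨-, hκ, hneg⟩ := hk x₀ u₀ h₀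
  have hW := contDiffOn_affine_comp hf hB hSX hκ hγ.1.1 hγS
  set W := fun s => affine f B (γ s) (k (γ s - x₀) x₀ u₀) with hWdef
  have hcont : ContinuousOn (fun s => (velocity γ s).ofLp ⬝ᵥ
      (lieDeriv M (W s) (γ s) *ᵥ (velocity γ s).ofLp) +
        2 * metricForm M (γ s) (velocity γ s) (velocity W s)) (Icc 0 1) := by
    have hD := ((contDiffOn_energyDensity hM).continuousOn_fderiv_of_isOpen
      (hX.prod isOpen_univ) le_rfl).comp (hγ.1.1.continuousOn.prodMk
        (continuousOn_velocity hγ.1.1)) fun s hs => ⟨hγ.1.2.1 s hs, mem_univ _⟩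
    refine (hD.clm_apply (hW.continuousOn.prodMk (continuousOn_velocity hW))).congr
      fun s hs => ?_
    have hsX := hγ.1.2.1 s hs
    exact (fderiv_energyDensity hX hM hsX (hMpos _ hsX) _ _ _).symm
  have key : firstVariation M γ W ≤ ∫ _ in (0 : ℝ)..1, -2 * lam * energy X M p q := by
    refine intervalIntegral.integral_mono_on zero_le_one
      (ContinuousOn.intervalIntegrable (by rwa [uIcc_of_le zero_le_one]))
      intervalIntegrable_const fun s hs => ?_
    rw [velocity_affine_comp hX hS hf hB hSX hκ hγ.1.1 hs (hγS s hs)]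
    rw [← hγ.metricForm_eq hMpos hs]
    set v := velocity γ s
    have h1 : v.ofLp ⬝ᵥ (weakMatrix f B M lam k x₀ u₀ (γ s) *ᵥ v.ofLp) ≤ 0 := by
      by_cases hv : v.ofLp = 0
      · simp [hv]
      · exact (hneg (γ s) (hγS s hs) v.ofLp hv).le
    have h2 : v.ofLp ⬝ᵥ (weakMatrix f B M lam k x₀ u₀ (γ s) *ᵥ v.ofLp) =
        v.ofLp ⬝ᵥ (lieDeriv M (W s) (γ s) *ᵥ v.ofLp) + 2 * metricForm M (γ s) v
          (WithLp.toLp 2 (closedLoopJacobian f B (fun y => k (y - x₀) x₀ u₀) (γ s) *ᵥ v.ofLp))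
          + 2 * lam * metricForm M (γ s) v v := by
      unfold weakMatrix
      rw [Matrix.add_mulVec, Matrix.add_mulVec, dotProduct_add, dotProduct_add,
        dotProduct_symHat_mulVec, ← Matrix.mulVec_mulVec, Matrix.smul_mulVec, dotProduct_smul]
      rfl
    linarith
  simpa using key

end ClosedLoop

/-! ### The trusted domain and the disturbance bound -/

section Disturbance

variable {n m N : ℕ}

theorem isOpen_trustedDomain (z : Fin N → StateControl n m) (r : ℝ) :
    IsOpen (trustedDomain z r) :=
  isOpen_iUnion fun _ => Metric.isOpen_ball

theorem isOpen_projState {D : Set (StateControl n m)} (hD : IsOpen D) : IsOpen (projState D) := by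
  have : projState D = ⋃ u : Vec m, (fun x : Vec n => pair x u) ⁻¹' D := by
    ext x; simp [projState]
  rw [this]
  refine isOpen_iUnion fun u => hD.preimage ?_
  exact (WithLp.prod_continuous_toLp 2 (Vec n) (Vec m)).comp (by fun_prop)

theorem norm_pair_sub_le (x x' : Vec n) (u u' : Vec m) (w : StateControl n m) :
    ‖pair x u - w‖ ≤ ‖x - x'‖ + ‖u - u'‖ + ‖pair x' u' - w‖ := by
  have h1 : pair x u - w = (pair x u - pair x' u') + (pair x' u' - w) := by abel
  have h2 : ‖pair x u - pair x' u'‖ ≤ ‖x - x'‖ + ‖u - u'‖ := by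
    rw [WithLp.prod_norm_eq_of_L2]
    refine Real.sqrt_le_iff.2 ⟨by positivity, ?_⟩
    change ‖x - x'‖ ^ 2 + ‖u - u'‖ ^ 2 ≤ _
    nlinarith [mul_nonneg (norm_nonneg (x - x')) (norm_nonneg (u - u'))]
  rw [h1]
  exact (norm_add_le _ _).trans (by linarith)

theorem continuousOn_iInf_fin [Nonempty (Fin N)] {φ : Fin N → ℝ → ℝ} {T : Set ℝ}
    (h : ∀ i, ContinuousOn (φ i) T) : ContinuousOn (fun t => ⨅ i, φ i t) T := by
  have : (fun t => ⨅ i, φ i t) = fun t => Finset.univ.inf' Finset.univ_nonempty fun i => φ i t := by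
    ext t
    rw [Finset.inf'_univ_eq_ciInf]
  rw [this]
  exact ContinuousOn.finset_inf'_apply Finset.univ_nonempty fun i _ => h i

/-- The triangle inequality transfers the bound to the nominal pair; L a is the same for every i and
leaves the minimum. -/
theorem iInf_disturbance_le [Nonempty (Fin N)] {L : ℝ} (hL : 0 ≤ L) (z : Fin N → StateControl n m)
    (err : Fin N → ℝ) {x x' : Vec n} {u u' : Vec m} {a b : ℝ} (ha : ‖x - x'‖ ≤ a)
    (hb : ‖u - u'‖ ≤ b) :
    (⨅ i, (L * ‖pair x u - z i‖ + err i)) ≤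
      L * a + ⨅ i, (L * (‖pair x' u' - z i‖ + b) + err i) := by
  rw [← sub_le_iff_le_add']
  refine le_ciInf fun i => ?_
  have h1 : (⨅ i, (L * ‖pair x u - z i‖ + err i)) ≤ L * ‖pair x u - z i‖ + err i :=
    ciInf_le (Finite.bddBelow_range _) i
  have h2 := mul_le_mul_of_nonneg_left (norm_pair_sub_le x x' u u' (z i)) hL
  have h3 := mul_le_mul_of_nonneg_left (add_le_add ha hb) hL
  linarith

end Disturbance

/-! ### Decay of the energy under either controller -/

/-- The controller makes the energy decay with rate `2 lam` up to the effect of the disturbance: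
the upper right Dini derivative of the energy is at most `-2 lam E + 2 γ_s(1)ᵀ M(x) d`. -/
theorem energy_eventually_le_of_contracting {n m : ℕ} {X : Set (Vec n)} {U : Set (Vec m)}
    (hX : IsOpen X) {f : Vec n → Vec n} {B : Vec n → Matrix (Fin n) (Fin m) ℝ}
    {M : Vec n → Matrix (Fin n) (Fin n) ℝ} (hf : ContDiffOn ℝ 1 f X) (hB : MatrixC1On B X)
    (hM : MatrixC1On M X) (hMpos : ∀ x ∈ X, (M x).PosDef) {D : Set (StateControl n m)}
    (hDo : IsOpen D) (hDX : projState D ⊆ X) {xs x : ℝ → Vec n} {us u : Vec m} {d : Vec n} {t : ℝ}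
    (hxs : HasDerivWithinAt xs (affine f B (xs t) us) (Ici t) t)
    (hx : HasDerivWithinAt x (affine f B (x t) u + d) (Ici t) t) (hnom : pair (xs t) us ∈ D)
    {γ : ℝ → Vec n} (hγ : IsMinGeodesic X M (xs t) (x t) γ)
    (hγD : ∀ s ∈ Icc (0 : ℝ) 1, γ s ∈ projState D) {lam : ℝ}
    (hctrl : u ∈ geodesicFeasible X U f B M lam γ (xs t) us (x t) ∨
      ∃ k : Vec n → Vec n → Vec m → Vec m, WeakCCM f B M lam k D ∧ u = k (x t - xs t) (xs t) us)
    {G : ℝ} (hG : -2 * lam * energy X M (xs t) (x t)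
      + 2 * metricForm M (x t) (velocity γ 1) d < G) :
    ∀ᶠ s in 𝓝[>] t, energy X M (xs s) (x s) ≤ energy X M (xs t) (x t) + (s - t) * G := by
  rcases hctrl with ⟨-, hu⟩ | ⟨k, hk, rfl⟩
  -- With the zero field only the end point terms remain, and the controller constraint bounds them
  -- by -2 lam E apart from the contribution of d.
  · refine energy_eventually_le hX hM hMpos hxs hx hγ (W := fun _ => 0) contDiffOn_const
      (lt_of_le_of_lt ?_ hG)
    have h0 : firstVariation M γ (fun _ => 0) = 0 := by
      have h1 : ∀ s, velocity (fun _ : ℝ => (0 : Vec n)) s = 0 := fun s => by simp [velocity]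
      have h2 : ∀ y, lieDeriv M 0 y = 0 := fun y => by ext i j; simp [lieDeriv]
      simp [firstVariation, h1, h2, metricForm]
    rw [h0, sub_zero, sub_zero, metricForm_add_right]
    linarith
  · obtain ⟨hk0, hkC, -⟩ := hk (xs t) us hnom
    have hS := isOpen_projState hDo
    -- The closed-loop field agrees with the nominal velocity at s = 0, because k returns u⋆ at zero
    -- deviation, and differs from the executed velocity at s = 1 by exactly d.
    refine energy_eventually_le hX hM hMpos hxs hx hγ
      (W := fun s => affine f B (γ s) (k (γ s - xs t) (xs t) us))
      (contDiffOn_affine_comp hf hB hDX hkC hγ.1.1 hγD) (lt_of_le_of_lt ?_ hG)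
    have h1 := hk.firstVariation_le hX hS hDX hf hB hM hMpos hnom hγ hγD
    simp only [hγ.1.2.2.1, hγ.1.2.2.2, sub_self, hk0, add_sub_cancel_left]
    have h2 : metricForm M (xs t) (velocity γ 0) 0 = 0 := by simp [metricForm]
    rw [h2]
    linarith

end CCM

/-! ### The tracking bound -/

theorem mainTheorem1 {n m N : ℕ}
    -- state space, control space, true dynamics, learned control-affine model, metric
    (X : Set (Vec n)) (U : Set (Vec m)) (hX : IsOpen X)
    (h : StateControl n m → Vec n)
    (f : Vec n → Vec n) (B : Vec n → Matrix (Fin n) (Fin m) ℝ)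
    (M : Vec n → Matrix (Fin n) (Fin n) ℝ)
    (hf : ContDiffOn ℝ 1 f X) (hB : MatrixC1On B X) (hM : MatrixC1On M X)
    (hMpos : ∀ x ∈ X, (M x).PosDef)
    -- training points, trusted domain, Lipschitz constant of the model error
    (z : Fin N → StateControl n m) (r : ℝ)
    (hD : ∀ w ∈ trustedDomain z r, w.fst ∈ X ∧ w.snd ∈ U)
    (L : ℝ≥0)
    (hL : LipschitzOnWith L (fun w => h w - affine f B w.fst w.snd) (trustedDomain z r))
    -- the eigenvalue bounds of the metric over the trusted domain are finite and positive
    (hhi : BddAbove ((fun x => maxEig (M x)) '' projState (trustedDomain z r)))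
    (hlo : 0 < infMinEig M (projState (trustedDomain z r)))
    -- nominal trajectory
    (t₁ t₂ : ℝ) (ht : t₁ < t₂)
    (xs : ℝ → Vec n) (us : ℝ → Vec m)
    (hxs : ContinuousOn xs (Icc t₁ t₂)) (hus : ContinuousOn us (Icc t₁ t₂))
    (hxs' : ∀ t ∈ Ico t₁ t₂, HasDerivWithinAt xs (affine f B (xs t) (us t)) (Ici t) t)
    (hnom : ∀ t ∈ Icc t₁ t₂, pair (xs t) (us t) ∈ trustedDomain z r)
    -- perturbed executed trajectory
    (x : ℝ → Vec n) (u : ℝ → Vec m) (d : ℝ → Vec n)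
    (hx : ContinuousOn x (Icc t₁ t₂))
    (hx' : ∀ t ∈ Ico t₁ t₂, HasDerivWithinAt x (affine f B (x t) (u t) + d t) (Ici t) t)
    -- minimizing geodesics from the nominal to the executed state, inside the trusted domain
    (γ : ℝ → ℝ → Vec n)
    (hγ : ∀ t ∈ Icc t₁ t₂, IsMinGeodesic X M (xs t) (x t) (γ t))
    (hγD : ∀ t ∈ Icc t₁ t₂, ∀ s ∈ Icc (0 : ℝ) 1, γ t s ∈ projState (trustedDomain z r))
    -- the controller is contracting with rate `lam`
    (lam : ℝ) (hlam : 0 < lam)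
    (hctrl :
      (StrongCCM f B M lam (projState (trustedDomain z r)) ∧
        ∀ t ∈ Ico t₁ t₂, IsGeodesicControl X U f B M lam (γ t) (xs t) (us t) (x t) (u t)) ∨
      (∃ k : Vec n → Vec n → Vec m → Vec m, WeakCCM f B M lam k (trustedDomain z r) ∧
        ∀ t ∈ Ico t₁ t₂, u t = k (x t - xs t) (xs t) (us t)))
    -- bound on the feedback part of the control
    (ufb : ℝ → ℝ) (hufb : ContinuousOn ufb (Icc t₁ t₂))
    (hufb' : ∀ t ∈ Ico t₁ t₂, ‖u t - us t‖ ≤ ufb t)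
    -- spatially varying bound on the disturbance
    (hd : ∀ t ∈ Ico t₁ t₂, ‖d t‖ ≤ ⨅ i, (L * ‖pair (x t) (u t) - z i‖
        + ‖h (z i) - affine f B (z i).fst (z i).snd‖))
    -- bound on the initial energy
    (E₁ : ℝ) (hE : energy X M (xs t₁) (x t₁) ≤ E₁) :
    ∃ e : ℝ → ℝ,
      IsMaximalSolution
        (energyRHS lam L (infMinEig M (projState (trustedDomain z r)))
          (supMaxEig M (projState (trustedDomain z r))) z
          (fun i => ‖h (z i) - affine f B (z i).fst (z i).snd‖) xs us ufb) t₁ t₂ E₁ e ∧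
      (0 < E₁ → ∀ e' : ℝ → ℝ,
        IsSolution
          (energyRHS lam L (infMinEig M (projState (trustedDomain z r)))
            (supMaxEig M (projState (trustedDomain z r))) z
            (fun i => ‖h (z i) - affine f B (z i).fst (z i).snd‖) xs us ufb) t₁ t₂ E₁ e' →
        EqOn e' e (Icc t₁ t₂)) ∧
      ∀ t ∈ Icc t₁ t₂,
        ‖x t - xs t‖ ≤ √(e t / infMinEig M (projState (trustedDomain z r))) := by
  set D := trustedDomain z r with hDdef
  set S := projState D with hSdef
  set lo := infMinEig M S with hlodef
  set hi := supMaxEig M S with hhidef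
  set err : Fin N → ℝ := fun i => ‖h (z i) - affine f B (z i).fst (z i).snd‖ with herr
  have hDo : IsOpen D := isOpen_trustedDomain z r
  have hS : IsOpen S := isOpen_projState hDo
  have hSX : S ⊆ X := fun y ⟨v, hv⟩ => (hD _ hv).1
  have hMS : ∀ y ∈ S, (M y).PosDef := fun y hy => hMpos y (hSX hy)
  have ht₁ : t₁ ∈ Icc t₁ t₂ := ⟨le_rfl, ht.le⟩
  have : Nonempty (Fin N) := by
    obtain ⟨i, -⟩ := mem_iUnion.1 (hnom t₁ ht₁)
    exact ⟨i⟩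
  -- the disturbance bound along the nominal trajectory
  set β : ℝ → ℝ := fun t => ⨅ i, (L * (‖pair (xs t) (us t) - z i‖ + ufb t) + err i) with hβ
  have hβc : ContinuousOn β (Icc t₁ t₂) := by
    have hpair : ContinuousOn (fun t => pair (xs t) (us t)) (Icc t₁ t₂) :=
      (WithLp.prod_continuous_toLp 2 (Vec n) (Vec m)).comp_continuousOn (hxs.prodMk hus)
    exact continuousOn_iInf_fin fun i => by fun_prop
  -- The feedback bound holds only before t₂; continuity carries nonnegativity to the final time.
  have hufb0 : ∀ t ∈ Icc t₁ t₂, 0 ≤ ufb t := by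
    have h0 : ∀ t ∈ Ico t₁ t₂, 0 ≤ ufb t := fun t htt => (norm_nonneg _).trans (hufb' t htt)
    intro t htt
    rw [← closure_Ico ht.ne] at htt hufb
    exact ContinuousWithinAt.closure_le htt continuousWithinAt_const
      ((hufb t htt).mono subset_closure) h0
  have hβ0 : ∀ t ∈ Icc t₁ t₂, 0 ≤ β t := fun t htt => Real.iInf_nonneg fun i =>
    add_nonneg (mul_nonneg L.2 (add_nonneg (norm_nonneg _) (hufb0 t htt))) (norm_nonneg _)
  -- Extended by constants outside the time interval, since the linear comparison needs b continuous
  -- and nonnegative on the whole line.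
  set b : ℝ → ℝ := fun t => √hi * IccExtend ht.le (domRestrict (Icc t₁ t₂) β) t with hb
  have hbc : Continuous b :=
    continuous_const.mul (continuousOn_iff_continuous_domRestrict.1 hβc).Icc_extend'
  have hb0 : ∀ t, 0 ≤ b t := fun t =>
    mul_nonneg (Real.sqrt_nonneg _) (hβ0 _ (projIcc t₁ t₂ ht.le t).2)
  have hbt : ∀ t ∈ Icc t₁ t₂, b t = √hi * β t := fun t htt => by
    simp only [hb, IccExtend_of_mem _ _ htt]; rfl
  set a := lam - L * √(hi / lo) with ha
  have hF : ∀ t ∈ Icc t₁ t₂, ∀ e, 0 ≤ e →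
      energyRHS lam L lo hi z err xs us ufb t e = -2 * a * e + 2 * √e * b t := by
    intro t htt e he
    rw [energyRHS, hbt t htt, Real.sqrt_mul he]
    ring
  have hE₁ : 0 ≤ E₁ := le_trans (sq_nonneg _) hE
  refine ⟨fun t => linSol a b t₁ (√E₁) t ^ 2, isMaximalSolution_sq_linSol ht.le hbc hb0 hF hE₁,
    fun hpos e' he' => eqOn_sq_linSol ht.le hbc hb0 hF hpos he', ?_⟩
  have hdist : ∀ t ∈ Icc t₁ t₂, ‖x t - xs t‖ ≤ riemannDist X M (xs t) (x t) / √lo := by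
    intro t htt
    have := (hγ t htt).norm_sub_le hMS hlo (hγD t htt) (s := 1) (r := 0) (by simp) (by simp)
    simpa [(hγ t htt).1.2.2.1, (hγ t htt).1.2.2.2] using this
  have hmain : ∀ t ∈ Icc t₁ t₂,
      energy X M (xs t) (x t) ≤ linSol a b t₁ (√E₁) t ^ 2 := by
    refine le_sq_linSol hbc hb0 (Real.sqrt_nonneg _) (by rwa [Real.sq_sqrt hE₁]) ?_ ?_
    · intro t htt ε hε
      exact energy_eventually_le_add hS hSX hM hMS hhi hlo hxs hx hγ hγD htt hε
    · intro t htt G hG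
      have htI : t ∈ Icc t₁ t₂ := ⟨htt.1, htt.2.le⟩
      have hγt := hγ t htI
      have hxS : x t ∈ S := by
        have := hγD t htI 1 (by simp)
        rwa [hγt.1.2.2.2] at this
      refine energy_eventually_le_of_contracting hX hf hB hM hMpos hDo hSX (hxs' t htt)
        (hx' t htt) (hnom t htI) hγt (hγD t htI) (lam := lam) (U := U) ?_
        (lt_of_le_of_lt ?_ hG)
      · rcases hctrl with ⟨-, hu⟩ | ⟨k, hk, hu⟩
        · exact Or.inl (hu t htt).1
        · exact Or.inr ⟨k, hk, hu t htt⟩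
      · set δ := riemannDist X M (xs t) (x t) with hδ
        have hδ0 : 0 ≤ δ := riemannDist_nonneg _ _
        have hen : energy X M (xs t) (x t) = δ ^ 2 := rfl
        -- The distance δ enters the bound on d through ‖x - x⋆‖ ≤ δ / √lo. Multiplied by 2 δ √hi,
        -- this gives the term 2 L √(hi / lo) E that reduces the rate from lam to a.
        have h1 := (hd t htt).trans
          (iInf_disturbance_le L.2 z err (hdist t htI) (hufb' t htt))
        change ‖d t‖ ≤ L * (δ / √lo) + β t at h1
        have h2 : metricForm M (x t) (velocity (γ t) 1) (d t) ≤ δ * (√hi * ‖d t‖) := by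
          refine (metricForm_le_mul_sqrt (hMS _ hxS) _ _).trans ?_
          have h3 := hγt.2 1 (by simp)
          rw [hγt.1.2.2.2] at h3
          rw [h3]
          exact mul_le_mul_of_nonneg_left (sqrt_metricForm_le hMS hhi hxS _) hδ0
        have h4 : δ * (√hi * ‖d t‖) ≤ δ * (√hi * (L * (δ / √lo) + β t)) := by gcongr
        rw [hen, hbt t htI, Real.sqrt_sq hδ0, ha, Real.sqrt_div' _ hlo.le]
        have h5 : δ * (√hi * (L * (δ / √lo) + β t)) =
            L * (√hi / √lo) * δ ^ 2 + δ * (√hi * β t) := by ring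
        linarith
  intro t htt
  refine (hdist t htt).trans ?_
  rw [Real.sqrt_div' _ hlo.le]
  gcongr
  exact Real.le_sqrt_of_sq_le (hmain t htt)
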